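/- Let $(V,\omega)$ be a real symplectic vector space of dimension $2g$, and let $Sp(V,\omega)\cong Sp(2g,\mathbb R)$ be its symplectic group. For $a\in V$ and $s\in\mathbb R$ let $T_a(s)\in Sp(V,\omega)$ be the map $x\mapsto x+s\,\omega(a,x)\,a$; the maps of this form are called symplectic transvections. Let $\Lambda(V,\omega)$ be the Lagrangian Grassmannian, i.e. the space of subspaces $L\subset V$ that equal their own $\omega$-orthogonal complement, and let $\pi:\widetilde\Lambda(V,\omega)\to\Lambda(V,\omega)$ and $\widetilde{Sp}(V,\omega)\to Sp(V,\omega)$ be the universal covers. The group $\widetilde{Sp}(V,\omega)$ acts on $\widetilde\Lambda(V,\omega)$ by the lift of the action of $Sp(V,\omega)$ on $\Lambda(V,\omega)$: if the universal covers are described by homotopy classes (with fixed endpoints) of paths starting at $1\in Sp(V,\omega)$ and at a base point of $\Lambda(V,\omega)$ respectively, then $[\gamma]\cdot[\ell]=[\tau\mapsto\gamma(\tau)\ell(\tau)]$. Let $t\in Sp(V,\omega)$ be a symplectic transvection. Then there is exactly one element $\tilde t\in\widetilde{Sp}(V,\omega)$ lying over $t$ that has a fixed point in $\widetilde\Lambda(V,\omega)$.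 Moreover, the fixed locus of this lift is the full preimage of the fixed locus of $t$: $$\operatorname{Fix}_{\tilde t}\bigl(\widetilde\Lambda(V,\omega)\bigr)=\pi^{-1}\bigl(\operatorname{Fix}_t(\Lambda(V,\omega))\bigr).$$ -/

import Mathlib

open scoped unitInterval

noncomputable section

/-! ### Universal covers -/

section UniversalCovers

/-- Paths in `X` starting at `x₀`, with the compact-open topology. -/
abbrev PathsFrom (X : Type*) [TopologicalSpace X] (x₀ : X) : Type _ :=
  {γ : C(I, X) // γ 0 = x₀}

/-- Homotopy with fixed endpoints. -/
def pathsFromSetoid (X : Type*) [TopologicalSpace X] (x₀ : X) : Setoid (PathsFrom X x₀) where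
  r γ δ := ContinuousMap.HomotopicRel γ.1 δ.1 {0, 1}
  iseqv :=
    ⟨fun γ => ContinuousMap.HomotopicRel.refl γ.1, fun h => h.symm, fun h k => h.trans k⟩

/-- The universal cover of `X` (connected and locally contractible in the applications below) with
base point `x₀`, in its standard construction: paths in `X` starting at `x₀`, up to homotopy with
fixed endpoints, with the quotient topology. -/
def UniversalCover (X : Type*) [TopologicalSpace X] (x₀ : X) : Type _ :=
  Quotient (pathsFromSetoid X x₀)

namespace UniversalCover

instance (X : Type*) [TopologicalSpace X] (x₀ : X) : TopologicalSpace (UniversalCover X x₀) :=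
  inferInstanceAs (TopologicalSpace (Quotient (pathsFromSetoid X x₀)))

/-- The class of a path. -/
def mk {X : Type*} [TopologicalSpace X] {x₀ : X} (γ : PathsFrom X x₀) : UniversalCover X x₀ :=
  Quotient.mk (pathsFromSetoid X x₀) γ

/-- The covering projection: the class of a path is sent to the endpoint of the path. -/
def proj {X : Type*} [TopologicalSpace X] {x₀ : X} : UniversalCover X x₀ → X :=
  Quotient.lift (fun γ : PathsFrom X x₀ => γ.1 1)
    (fun _ _ h => ContinuousMap.HomotopicRel.fst_eq_snd h (by simp))

theorem continuous_proj {X : Type*} [TopologicalSpace X] {x₀ : X} :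
    Continuous (proj : UniversalCover X x₀ → X) :=
  Continuous.quotient_lift (by fun_prop) _

section Act

variable {G : Type*} [TopologicalSpace G] [Group G]
  {X : Type*} [TopologicalSpace X] [MulAction G X] [ContinuousSMul G X] {x₀ : X}

/-- A path of group elements starting at `1` moves a path of points, pointwise in time. -/
def actPath (γ : PathsFrom G 1) (l : PathsFrom X x₀) : PathsFrom X x₀ :=
  ⟨⟨fun s => γ.1 s • l.1 s, by fun_prop⟩, by simp [γ.2, l.2]⟩

theorem actPath_homotopic {γ γ' : PathsFrom G 1} {l l' : PathsFrom X x₀}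
    (h : ContinuousMap.HomotopicRel γ.1 γ'.1 {0, 1})
    (k : ContinuousMap.HomotopicRel l.1 l'.1 {0, 1}) :
    ContinuousMap.HomotopicRel (actPath γ l).1 (actPath γ' l').1 {0, 1} := by
  obtain ⟨H⟩ := h
  obtain ⟨K⟩ := k
  refine ⟨⟨⟨⟨fun p => H p • K p, by fun_prop⟩, ?_, ?_⟩, ?_⟩⟩
  · intro s; simp [actPath]
  · intro s; simp [actPath]
  · intro u s hs
    have h1 := H.eq_fst u hs
    have h2 := K.eq_fst u hs
    simp [actPath, h1, h2]

variable [IsTopologicalGroup G]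

/-- The operation `[γ] • [l] = [s ↦ γ s • l s]`. -/
def act (a : UniversalCover G 1) (x : UniversalCover X x₀) : UniversalCover X x₀ :=
  Quotient.map₂ (sa := pathsFromSetoid G 1) (sb := pathsFromSetoid X x₀)
    (sc := pathsFromSetoid X x₀) actPath (fun _ _ h _ _ k => actPath_homotopic h k) a x

/-- The pointwise inverse of a path of group elements. -/
def invPath (γ : PathsFrom G 1) : PathsFrom G 1 :=
  ⟨⟨fun s => (γ.1 s)⁻¹, by fun_prop⟩, by simp [γ.2]⟩

/-- The operation `[γ]⁻¹ = [s ↦ (γ s)⁻¹]`. -/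
def inverse (a : UniversalCover G 1) : UniversalCover G 1 :=
  Quotient.map (sa := pathsFromSetoid G 1) (sb := pathsFromSetoid G 1) invPath
    (fun _ _ h => h.comp_continuousMap ⟨fun g : G => g⁻¹, by fun_prop⟩) a

/-- The group structure on the universal cover of a topological group, with base point `1`:
multiplication is induced by pointwise multiplication of paths. -/
instance : Group (UniversalCover G 1) where
  mul a b := act a b
  one := mk ⟨ContinuousMap.const I 1, rfl⟩
  inv a := inverse a
  mul_assoc a b c := by
    induction a using Quotient.inductionOn
    induction b using Quotient.inductionOn
    induction c using Quotient.inductionOn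
    exact congrArg mk (Subtype.ext (ContinuousMap.ext fun s => mul_assoc _ _ _))
  one_mul a := by
    induction a using Quotient.inductionOn
    exact congrArg mk (Subtype.ext (ContinuousMap.ext fun s => one_mul _))
  mul_one a := by
    induction a using Quotient.inductionOn
    exact congrArg mk (Subtype.ext (ContinuousMap.ext fun s => mul_one _))
  inv_mul_cancel a := by
    induction a using Quotient.inductionOn
    exact congrArg mk (Subtype.ext (ContinuousMap.ext fun s => inv_mul_cancel _))

/-- The universal cover of a topological group acts on the universal cover of every space on which
the group acts continuously. This is the action that lifts the action of the group. -/
instance : MulAction (UniversalCover G 1) (UniversalCover X x₀) where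
  smul a x := act a x
  one_smul x := by
    induction x using Quotient.inductionOn
    exact congrArg mk (Subtype.ext (ContinuousMap.ext fun s => one_smul _ _))
  mul_smul a b x := by
    induction a using Quotient.inductionOn
    induction b using Quotient.inductionOn
    induction x using Quotient.inductionOn
    exact congrArg mk (Subtype.ext (ContinuousMap.ext fun s => mul_smul _ _ _))

theorem proj_mul (a b : UniversalCover G 1) : proj (a * b) = proj a * proj b := by
  induction a using Quotient.inductionOn
  induction b using Quotient.inductionOn
  rfl

theorem proj_smul (a : UniversalCover G 1) (x : UniversalCover X x₀) :
    proj (a • x) = proj a • proj x := by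
  induction a using Quotient.inductionOn
  induction x using Quotient.inductionOn
  rfl

end Act

end UniversalCover

end UniversalCovers

/-! ### Symplectic linear algebra -/

/-- A symplectic form on a real vector space: an alternating nondegenerate bilinear form. -/
structure SymplecticForm (V : Type*) [AddCommGroup V] [Module ℝ V] where
  form : LinearMap.BilinForm ℝ V
  alt : form.IsAlt
  nondegenerate : form.Nondegenerate

section Symplectic

variable {V : Type*} [NormedAddCommGroup V] [NormedSpace ℝ V]

/-- The real symplectic group, a topological group as a subgroup of the group of units of the
normed algebra of endomorphisms of `V`. -/
def Sp (ω : SymplecticForm V) : Subgroup (V →L[ℝ] V)ˣ where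
  carrier := {u | ∀ x y, ω.form ((u : V →L[ℝ] V) x) ((u : V →L[ℝ] V) y) = ω.form x y}
  mul_mem' := by
    intro u v hu hv x y
    have := hu ((v : V →L[ℝ] V) x) ((v : V →L[ℝ] V) y)
    simpa [hv x y] using this
  one_mem' := by intro x y; simp
  inv_mem' := by
    intro u hu x y
    have hx : ∀ z, (u : V →L[ℝ] V) ((↑u⁻¹ : V →L[ℝ] V) z) = z := fun z => by
      rw [← mul_apply_eq_comp, Units.mul_inv, one_apply_eq_self]
    have := hu ((↑u⁻¹ : V →L[ℝ] V) x) ((↑u⁻¹ : V →L[ℝ] V) y)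
    rw [hx, hx] at this
    exact this.symm

/-- A subspace is Lagrangian when it equals its own orthogonal complement. -/
def IsLagrangian (ω : SymplecticForm V) (L : Submodule ℝ V) : Prop :=
  ω.form.orthogonal L = L

/-- The Lagrangian Grassmannian: the set of all Lagrangian subspaces. -/
def LagrangianGrassmannian (ω : SymplecticForm V) : Type _ :=
  {L : Submodule ℝ V // IsLagrangian ω L}

/-- Lagrangian frames: injective linear maps `ℝ^g → V` (where `dim V = 2g`) with Lagrangian
image. -/
abbrev LagrangianFrame (ω : SymplecticForm V) : Type _ :=
  {f : (Fin (Module.finrank ℝ V / 2) → ℝ) →L[ℝ] V //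
    Function.Injective f ∧ IsLagrangian ω (LinearMap.range f.toLinearMap)}

/-- The Lagrangian subspace spanned by a frame. -/
def LagrangianFrame.span {ω : SymplecticForm V} (f : LagrangianFrame ω) :
    LagrangianGrassmannian ω :=
  ⟨LinearMap.range f.1.toLinearMap, f.2.2⟩

/-- The usual topology of the Lagrangian Grassmannian (as a subspace of the Grassmannian): the
quotient topology with respect to the map that sends a frame to its span. -/
instance (ω : SymplecticForm V) : TopologicalSpace (LagrangianGrassmannian ω) :=
  TopologicalSpace.coinduced LagrangianFrame.span inferInstance

theorem Sp.inv_apply_apply {ω : SymplecticForm V} (u : Sp ω) (x : V) :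
    ((↑(u⁻¹ : Sp ω) : (V →L[ℝ] V)ˣ) : V →L[ℝ] V) ((u.1 : V →L[ℝ] V) x) = x := by
  change ((u.1⁻¹ : (V →L[ℝ] V)ˣ) * (u.1 : V →L[ℝ] V)) x = x
  simp

theorem Sp.apply_inv_apply {ω : SymplecticForm V} (u : Sp ω) (x : V) :
    (u.1 : V →L[ℝ] V) (((↑(u⁻¹ : Sp ω) : (V →L[ℝ] V)ˣ) : V →L[ℝ] V) x) = x := by
  change ((u.1 : V →L[ℝ] V) * (u.1⁻¹ : (V →L[ℝ] V)ˣ)) x = x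
  simp

theorem IsLagrangian.map {ω : SymplecticForm V} {L : Submodule ℝ V} (hL : IsLagrangian ω L)
    (u : Sp ω) : IsLagrangian ω (L.map ((u.1 : V →L[ℝ] V) : V →ₗ[ℝ] V)) := by
  ext y
  rw [LinearMap.BilinForm.mem_orthogonal_iff]
  constructor
  · intro h
    refine ⟨((↑(u⁻¹ : Sp ω) : (V →L[ℝ] V)ˣ) : V →L[ℝ] V) y, ?_, Sp.apply_inv_apply u y⟩
    rw [SetLike.mem_coe, ← (hL : ω.form.orthogonal L = L),
      LinearMap.BilinForm.mem_orthogonal_iff]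
    intro n hn
    have := h _ ⟨n, hn, rfl⟩
    have h2 := u.2 n (((↑(u⁻¹ : Sp ω) : (V →L[ℝ] V)ˣ) : V →L[ℝ] V) y)
    rw [Sp.apply_inv_apply] at h2
    exact h2 ▸ this
  · rintro ⟨z, hz, rfl⟩ _ ⟨n, hn, rfl⟩
    rw [SetLike.mem_coe, ← (hL : ω.form.orthogonal L = L),
      LinearMap.BilinForm.mem_orthogonal_iff] at hz
    exact (u.2 n z).trans (hz n hn)

/-- The symplectic group acts on Lagrangian subspaces by taking images. -/
instance (ω : SymplecticForm V) : MulAction (Sp ω) (LagrangianGrassmannian ω) where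
  smul u L := ⟨L.1.map ((u.1 : V →L[ℝ] V) : V →ₗ[ℝ] V), L.2.map u⟩
  one_smul L := Subtype.ext (Submodule.map_id L.1)
  mul_smul u v L := Subtype.ext (Submodule.map_comp
    ((v.1 : V →L[ℝ] V) : V →ₗ[ℝ] V) ((u.1 : V →L[ℝ] V) : V →ₗ[ℝ] V) L.1)

/-- The symplectic map `T_a(s) : x ↦ x + s ω(a, x) a`. -/
def transvection [FiniteDimensional ℝ V] (ω : SymplecticForm V) (a : V) (s : ℝ) : Sp ω :=
  ⟨{ val := ContinuousLinearMap.id ℝ V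
        + s • (LinearMap.toContinuousLinearMap (ω.form a)).smulRight a
     inv := ContinuousLinearMap.id ℝ V
        - s • (LinearMap.toContinuousLinearMap (ω.form a)).smulRight a
     val_inv := by ext x; simp [ω.alt a]
     inv_val := by ext x; simp [ω.alt a] }, by
    intro x y
    have h : ω.form x a = - ω.form a x := by
      rw [LinearMap.IsAlt.neg ω.alt a x]
    simp [ω.alt a, h]
    ring⟩

theorem transvection_apply [FiniteDimensional ℝ V] (ω : SymplecticForm V) (a : V) (s : ℝ) (x : V) :
    ((transvection ω a s).1 : V →L[ℝ] V) x = x + (s * ω.form a x) • a := by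
  simp [transvection, mul_smul]

/-- Symplectic transvections are the maps `T_a(s)` with `a ∈ V` and `s ∈ ℝ`. -/
def IsSymplecticTransvection [FiniteDimensional ℝ V] (ω : SymplecticForm V) (t : Sp ω) : Prop :=
  ∃ (a : V) (s : ℝ), t = transvection ω a s

end Symplectic

section Topology

variable {V : Type*} [NormedAddCommGroup V] [NormedSpace ℝ V] [FiniteDimensional ℝ V]

theorem LagrangianFrame.span_surjective (ω : SymplecticForm V) :
    Function.Surjective (LagrangianFrame.span (ω := ω)) := by
  intro L
  have h := LinearMap.BilinForm.finrank_orthogonal ω.nondegenerate L.1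
  rw [(L.2 : ω.form.orthogonal L.1 = L.1)] at h
  have h' := Submodule.finrank_le L.1
  have hd : Module.finrank ℝ (Fin (Module.finrank ℝ V / 2) → ℝ) = Module.finrank ℝ L.1 := by
    rw [Module.finrank_fin_fun]; omega
  let e := LinearEquiv.ofFinrankEq (Fin (Module.finrank ℝ V / 2) → ℝ) L.1 hd
  have hr : LinearMap.range (L.1.subtype ∘ₗ e.toLinearMap) = L.1 := by
    rw [LinearMap.range_comp, LinearEquiv.range, Submodule.map_top, Submodule.range_subtype]
  refine ⟨⟨LinearMap.toContinuousLinearMap (L.1.subtype ∘ₗ e.toLinearMap), ?_, ?_⟩, ?_⟩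
  · exact Subtype.val_injective.comp e.injective
  · exact hr.symm ▸ L.2
  · exact Subtype.ext hr

theorem LagrangianFrame.isOpenQuotientMap_span (ω : SymplecticForm V) :
    IsOpenQuotientMap (LagrangianFrame.span (ω := ω)) := by
  refine ⟨LagrangianFrame.span_surjective ω, continuous_coinduced_rng, ?_⟩
  intro U hU
  rw [isOpen_coinduced, isOpen_iff_forall_mem_open]
  rintro f ⟨f', hf', hspan⟩
  have hr : LinearMap.range f'.1.toLinearMap = LinearMap.range f.1.toLinearMap :=
    congrArg Subtype.val hspan
  let A : (Fin (Module.finrank ℝ V / 2) → ℝ) ≃ₗ[ℝ] (Fin (Module.finrank ℝ V / 2) → ℝ) :=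
    (LinearEquiv.ofInjective f'.1.toLinearMap f'.2.1).trans
      ((LinearEquiv.ofEq _ _ hr).trans (LinearEquiv.ofInjective f.1.toLinearMap f.2.1).symm)
  have hA : ∀ x, f.1 (A x) = f'.1 x := by
    intro x
    have := LinearEquiv.apply_symm_apply (LinearEquiv.ofInjective f.1.toLinearMap f.2.1)
      (LinearEquiv.ofEq _ _ hr (LinearEquiv.ofInjective f'.1.toLinearMap f'.2.1 x))
    exact congrArg Subtype.val this
  let Ac : (Fin (Module.finrank ℝ V / 2) → ℝ) →L[ℝ] (Fin (Module.finrank ℝ V / 2) → ℝ) :=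
    A.toContinuousLinearEquiv
  have hrA : ∀ h : (Fin (Module.finrank ℝ V / 2) → ℝ) →L[ℝ] V,
      LinearMap.range (h.comp Ac).toLinearMap
        = LinearMap.range h.toLinearMap := by
    intro h
    ext y
    constructor
    · rintro ⟨x, rfl⟩; exact ⟨A x, rfl⟩
    · rintro ⟨x, rfl⟩; exact ⟨A.symm x, congrArg h (A.apply_symm_apply x)⟩
  let R : LagrangianFrame ω → LagrangianFrame ω := fun h =>
    ⟨h.1.comp Ac,
      h.2.1.comp A.injective, (hrA h.1).symm ▸ h.2.2⟩
  have hR : Continuous R := by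
    refine Continuous.subtype_mk ?_ _
    exact (continuous_subtype_val).clm_comp continuous_const
  refine ⟨R ⁻¹' U, ?_, hU.preimage hR, ?_⟩
  · intro h hh
    exact ⟨R h, hh, Subtype.ext (hrA h.1)⟩
  · have : R f = f' := Subtype.ext (ContinuousLinearMap.ext hA)
    change R f ∈ U
    rwa [this]

instance (ω : SymplecticForm V) : ContinuousSMul (Sp ω) (LagrangianGrassmannian ω) where
  continuous_smul := by
    have hq := (IsOpenQuotientMap.id (X := Sp ω)).prodMap
      (LagrangianFrame.isOpenQuotientMap_span ω)
    rw [← hq.continuous_comp_iff]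
    have hr : ∀ (u : Sp ω) (f : LagrangianFrame ω),
        LinearMap.range ((u.1 : V →L[ℝ] V).comp f.1).toLinearMap
          = (LinearMap.range f.1.toLinearMap).map ((u.1 : V →L[ℝ] V) : V →ₗ[ℝ] V) :=
      fun u f => LinearMap.range_comp _ _
    have hinj : ∀ u : Sp ω, Function.Injective (u.1 : V →L[ℝ] V) := fun u =>
      Function.LeftInverse.injective (Sp.inv_apply_apply u)
    let m : Sp ω × LagrangianFrame ω → LagrangianFrame ω := fun p =>
      ⟨(p.1.1 : V →L[ℝ] V).comp p.2.1, (hinj p.1).comp p.2.2.1,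
        (hr p.1 p.2).symm ▸ p.2.2.2.map p.1⟩
    have hm : Continuous m := by
      refine Continuous.subtype_mk ?_ _
      exact (Units.continuous_val.comp (continuous_subtype_val.comp continuous_fst)).clm_comp
        (continuous_subtype_val.comp continuous_snd)
    have : (fun p : Sp ω × LagrangianGrassmannian ω => p.1 • p.2) ∘
        Prod.map id LagrangianFrame.span = LagrangianFrame.span ∘ m := by
      funext p
      exact Subtype.ext (hr p.1 p.2).symm
    rw [this]
    exact (LagrangianFrame.isOpenQuotientMap_span ω).continuous.comp hm

end Topology

end

/-! Write `t = T_a(s)` and lift it along the path `r ↦ T_a(rs)`. For `s ≠ 0`, `T_a(s)` fixes a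
Lagrangian `L` exactly when `a ∈ L`, and then the whole path fixes `L`. A path of group elements
that fixes the endpoint of `l` fixes the class of `l`. Hence this lift fixes every point above a
fixed point of `t` (`transvectionLift_smul_eq_iff`), and such points exist because some Lagrangian
in the component of the base point contains `a`.

A lift of `t` that fixes a point `x` differs from this one by an element of `π₁(Sp)` that also fixes
`x`. Everything therefore reduces to the freeness of the action of `π₁(Sp)` on the universal cover
of the Lagrangian Grassmannian (`UniversalCover.eq_one_of_smul_eq`). Fix a compatible complex
structure `J`. Every loop in `Sp` is homotopic to a path of rotations by angles `θ` in one plane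
spanned by `e` and `J e` (`exists_rotPath`). Such a rotation multiplies the Maslov phase by
`exp(-2iθ)` (`phase_rot_smul`), so a fixed point forces the total angle to be `0`, and the loop
contracts by scaling `θ`.

The reduction to rotations is an induction. Suppose the loop fixes a `J`-stable subspace `W`
pointwise, and let `e` be a unit vector of the complement. If the complement has dimension above
`2`, the loop of images of `e` can be moved off a line and then contracted to `e`; a shear then
straightens the images of `J e`, and `W` grows by a plane. If the complement is a plane, the angle
of the image of `e` is lifted to `ℝ`. -/

noncomputable section

/-! ### Homotopies of paths in universal covers -/

namespace UniversalCover

theorem mk_eq_mk_of_homotopy {X : Type*} [TopologicalSpace X] {x₀ : X} {γ δ : PathsFrom X x₀}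
    (H : I × I → X) (hc : Continuous H) (h0 : ∀ s, H (0, s) = γ.1 s) (h1 : ∀ s, H (1, s) = δ.1 s)
    (hl : ∀ u, H (u, 0) = x₀) (hr : ∀ u, H (u, 1) = γ.1 1) : mk γ = mk δ := by
  refine Quotient.sound (s := pathsFromSetoid X x₀) ⟨⟨⟨⟨H, hc⟩, h0, h1⟩, ?_⟩⟩
  intro u s hs
  rcases hs with rfl | rfl
  · exact (hl u).trans γ.2.symm
  · exact hr u

section Group

variable {G : Type*} [TopologicalSpace G] [Group G] [IsTopologicalGroup G]

/-- All deformations of loops in `Sp` below have this shape: a correcting factor `α` grows from `1`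
and stays trivial at both ends of the loop. -/
theorem mk_eq_mk_of_mul_homotopy {γ δ : PathsFrom G 1} (α : I × I → G) (hc : Continuous α)
    (h0 : ∀ s, α (0, s) = 1) (h1 : ∀ s, δ.1 s = α (1, s) * γ.1 s)
    (hl : ∀ u, α (u, 0) = 1) (hr : ∀ u, α (u, 1) = 1) : mk γ = mk δ := by
  refine mk_eq_mk_of_homotopy (fun p => α p * γ.1 p.2) (by fun_prop) ?_ ?_ ?_ ?_
  · intro s; simp [h0]
  · intro s; simp [h1]
  · intro u; simp [hl, γ.2]
  · intro u; simp [hr]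

theorem mk_eq_one_of_forall {γ : PathsFrom G 1} (h : ∀ s, γ.1 s = 1) : mk γ = 1 :=
  congrArg mk (Subtype.ext (ContinuousMap.ext h))

theorem mk_smul_mk {X : Type*} [TopologicalSpace X] [MulAction G X] [ContinuousSMul G X] {x₀ : X}
    (γ : PathsFrom G 1) (l : PathsFrom X x₀) : mk γ • mk l = mk (actPath γ l) := rfl

/-- A path of group elements that fixes the endpoint of a path of points fixes the class of the
latter. -/
theorem mk_smul_eq_self {X : Type*} [TopologicalSpace X] [MulAction G X] [ContinuousSMul G X]
    {x₀ : X} (γ : PathsFrom G 1) (l : PathsFrom X x₀) (h : ∀ s, γ.1 s • l.1 1 = l.1 1) :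
    mk γ • mk l = mk l := by
  let γ' : ℝ → G := Set.IccExtend zero_le_one γ.1
  let l' : ℝ → X := Set.IccExtend zero_le_one l.1
  have hγ' : Continuous γ' := γ.1.continuous.Icc_extend'
  have hl' : Continuous l' := l.1.continuous.Icc_extend'
  have γ0 : ∀ r ≤ 0, γ' r = 1 := fun r hr =>
    (Set.IccExtend_of_le_left zero_le_one γ.1 hr).trans γ.2
  have l0 : ∀ r ≤ 0, l' r = x₀ := fun r hr =>
    (Set.IccExtend_of_le_left zero_le_one l.1 hr).trans l.2
  have l1 : ∀ r, 1 ≤ r → l' r = l.1 1 := fun r hr =>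
    Set.IccExtend_of_right_le zero_le_one l.1 hr
  have γI : ∀ s : I, γ' s = γ.1 s := fun s => Set.IccExtend_val zero_le_one γ.1 s
  have lI : ∀ s : I, l' s = l.1 s := fun s => Set.IccExtend_val zero_le_one l.1 s
  have hfix : ∀ r, γ' r • l.1 1 = l.1 1 := fun r => h _
  let m : PathsFrom X x₀ := ⟨⟨fun s => l' (2 * s), by fun_prop⟩, l0 _ (by simp)⟩
  rw [mk_smul_mk]
  trans mk m
  -- Sliding the two factors apart in time turns `γ s • l s` into "run `l` at double speed, then
  -- apply `γ`". The second half is constant because `γ` fixes the endpoint of `l`. What remains is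
  -- a reparametrization of `l`.
  · refine mk_eq_mk_of_homotopy
      (fun p => γ' (p.2 - p.1 * (1 - p.2)) • l' ((1 + p.1) * p.2)) (by fun_prop) ?_ ?_ ?_ ?_
    · intro s
      simp [actPath, γI, lI]
    · intro s
      change γ' ((s : ℝ) - 1 * (1 - s)) • l' ((1 + 1) * s) = l' (2 * s)
      rcases le_total (s : ℝ) (1 / 2) with hs | hs
      · rw [γ0 _ (by linarith), one_smul]; norm_num
      · rw [l1 _ (by linarith), l1 _ (by linarith), hfix]
    · intro u
      have := u.2.1
      change γ' (0 - u * (1 - 0)) • l' ((1 + u) * 0) = x₀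
      rw [γ0 _ (by linarith), one_smul, l0 _ (by simp)]
    · intro u
      have := u.2.1
      change γ' (1 - u * (1 - 1)) • l' ((1 + u) * 1) = γ.1 1 • l.1 1
      rw [l1 _ (by linarith), hfix, h]
  · refine mk_eq_mk_of_homotopy (fun p => l' ((2 - p.1) * p.2)) (by fun_prop) ?_ ?_ ?_ ?_
    · intro s; simp [m]
    · intro s
      change l' ((2 - 1) * s) = _
      rw [← lI]; norm_num
    · intro u; exact l0 _ (by simp)
    · intro u
      have := u.2.2
      change l' ((2 - u) * 1) = l' (2 * 1)
      rw [l1 _ (by linarith), l1 _ (by norm_num)]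

end Group

end UniversalCover

/-! ### Evaluation of symplectic maps, and transvections -/

section Transvection

variable {V : Type*} [NormedAddCommGroup V] [NormedSpace ℝ V] {ω : SymplecticForm V}

theorem SymplecticForm.form_swap (ω : SymplecticForm V) (x y : V) : ω.form x y = -ω.form y x := by
  rw [LinearMap.IsAlt.neg ω.alt y x]

@[simp]
theorem SymplecticForm.form_self (ω : SymplecticForm V) (x : V) : ω.form x x = 0 := ω.alt x

/-- Evaluation of a symplectic map at a vector. -/
def Sp.app (u : Sp ω) (x : V) : V := (u.1 : V →L[ℝ] V) x

@[simp] theorem Sp.app_one (x : V) : Sp.app (1 : Sp ω) x = x := rfl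

@[simp] theorem Sp.app_mul (u v : Sp ω) (x : V) : Sp.app (u * v) x = Sp.app u (Sp.app v x) := rfl

theorem Sp.form_app (u : Sp ω) (x y : V) : ω.form (Sp.app u x) (Sp.app u y) = ω.form x y := u.2 x y

theorem Sp.app_add (u : Sp ω) (x y : V) : Sp.app u (x + y) = Sp.app u x + Sp.app u y :=
  map_add (u.1 : V →L[ℝ] V) x y

theorem Sp.app_smul (u : Sp ω) (r : ℝ) (x : V) : Sp.app u (r • x) = r • Sp.app u x :=
  map_smul (u.1 : V →L[ℝ] V) r x

theorem Sp.app_injective (u : Sp ω) : Function.Injective (Sp.app u) :=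
  Function.LeftInverse.injective (Sp.inv_apply_apply u)

@[simp] theorem Sp.app_zero (u : Sp ω) : Sp.app u 0 = 0 := map_zero (u.1 : V →L[ℝ] V)

theorem Sp.app_ne_zero (u : Sp ω) {x : V} (hx : x ≠ 0) : Sp.app u x ≠ 0 := fun h =>
  hx (Sp.app_injective u (h.trans (Sp.app_zero u).symm))

@[simp] theorem Sp.app_inv_app (u : Sp ω) (x : V) : Sp.app (u⁻¹) (Sp.app u x) = x :=
  Sp.inv_apply_apply u x

theorem Sp.app_inv_eq (u : Sp ω) {x : V} (h : Sp.app u x = x) : Sp.app (u⁻¹) x = x :=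
  Sp.app_injective u ((Sp.apply_inv_apply u x).trans h.symm)

theorem Sp.ext_app {u v : Sp ω} (h : ∀ x, Sp.app u x = Sp.app v x) : u = v :=
  Subtype.ext (Units.ext (ContinuousLinearMap.ext h))

@[fun_prop]
theorem Continuous.sp_app {P : Type*} [TopologicalSpace P] {u : P → Sp ω} {x : P → V}
    (hu : Continuous u) (hx : Continuous x) : Continuous fun p => Sp.app (u p) (x p) :=
  ((Units.continuous_val.comp continuous_subtype_val).comp hu).clm_apply hx

theorem LagrangianGrassmannian.mem_smul_iff (u : Sp ω) (L : LagrangianGrassmannian ω) (y : V) :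
    y ∈ (u • L).1 ↔ ∃ x ∈ L.1, Sp.app u x = y := Iff.rfl

variable [FiniteDimensional ℝ V]

@[fun_prop]
theorem SymplecticForm.continuous_form (ω : SymplecticForm V) {P : Type*} [TopologicalSpace P]
    {x y : P → V} (hx : Continuous x) (hy : Continuous y) :
    Continuous fun p => ω.form (x p) (y p) := by
  let B : V →L[ℝ] V →L[ℝ] ℝ := LinearMap.toContinuousLinearMap
    ((LinearMap.toContinuousLinearMap : (V →ₗ[ℝ] ℝ) ≃ₗ[ℝ] (V →L[ℝ] ℝ)).toLinearMap ∘ₗ ω.form)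
  exact (B.continuous.comp hx).clm_apply hy

@[simp]
theorem Sp.app_transvection (a : V) (s : ℝ) (x : V) :
    Sp.app (transvection ω a s) x = x + (s * ω.form a x) • a := transvection_apply ω a s x

/-- A family of symplectic maps is continuous as soon as it and its inverse are pointwise
continuous. -/
theorem Sp.continuous_of_app {P : Type*} [TopologicalSpace P] {u : P → Sp ω}
    (h : ∀ x, Continuous fun p => Sp.app (u p) x) (h' : ∀ x, Continuous fun p => Sp.app ((u p)⁻¹) x) :
    Continuous u := by
  refine Continuous.subtype_mk (Units.continuous_iff.2 ⟨?_, ?_⟩) _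
  · exact continuous_clm_apply.2 h
  · exact continuous_clm_apply.2 h'

theorem transvection_mul_neg (a : V) (s r : ℝ) (h : s = -r) :
    transvection ω a s * transvection ω a r = 1 := by
  subst h
  refine Sp.ext_app fun x => ?_
  simp

theorem transvection_inv (a : V) (s : ℝ) : (transvection ω a s)⁻¹ = transvection ω a (-s) :=
  inv_eq_of_mul_eq_one_right (transvection_mul_neg a _ _ (by simp))

theorem transvection_neg (a : V) (s : ℝ) : transvection ω (-a) s = transvection ω a s := by
  refine Sp.ext_app fun x => ?_
  simp

@[simp] theorem transvection_zero_right (a : V) : transvection ω a 0 = 1 :=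
  Sp.ext_app fun x => by simp

@[simp] theorem transvection_zero_left (s : ℝ) : transvection ω (0 : V) s = 1 :=
  Sp.ext_app fun x => by simp

@[fun_prop]
theorem Continuous.transvection {P : Type*} [TopologicalSpace P] {a : P → V} {s : P → ℝ}
    (ha : Continuous a) (hs : Continuous s) : Continuous fun p => transvection ω (a p) (s p) := by
  refine Sp.continuous_of_app (fun x => ?_) (fun x => ?_)
  · simp only [Sp.app_transvection]; fun_prop
  · simp only [transvection_inv, Sp.app_transvection]; fun_prop

end Transvection

/-! ### Compatible complex structures -/

/-- A complex structure `J` that is compatible with `ω`: `ω(x, J y)` is an inner product. -/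
structure CompatibleComplexStructure {V : Type*} [AddCommGroup V] [Module ℝ V]
    (ω : SymplecticForm V) where
  J : V →ₗ[ℝ] V
  sq : ∀ x, J (J x) = -x
  symp : ∀ x y, ω.form (J x) (J y) = ω.form x y
  pos : ∀ x, x ≠ 0 → 0 < ω.form x (J x)

/-- Split off a hyperbolic plane with `B e f = 1`, set `J e = f` and `J f = -e`, and use induction
on the orthogonal complement `U`. The hypotheses concern a bare bilinear form so that they pass to
`U`. -/
theorem LinearMap.BilinForm.IsAlt.exists_compatible {V : Type*} [AddCommGroup V] [Module ℝ V]
    [FiniteDimensional ℝ V] (B : LinearMap.BilinForm ℝ V) (hB : B.IsAlt)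
    (hn : ∀ x, (∀ y, B x y = 0) → x = 0) :
    ∃ J : V →ₗ[ℝ] V, (∀ x, J (J x) = -x) ∧ (∀ x y, B (J x) (J y) = B x y) ∧
      ∀ x, x ≠ 0 → 0 < B x (J x) := by
  induction h : Module.finrank ℝ V using Nat.strong_induction_on generalizing V with
  | _ n ih =>
  have swap : ∀ x y, B x y = -B y x := fun x y => by rw [LinearMap.IsAlt.neg hB y x]
  have self : ∀ x, B x x = 0 := hB
  rcases subsingleton_or_nontrivial V with hV | hV
  · exact ⟨0, fun x => Subsingleton.elim _ _, fun x y => by simp [Subsingleton.elim x 0],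
      fun x hx => (hx (Subsingleton.elim _ _)).elim⟩
  obtain ⟨e, he⟩ := exists_ne (0 : V)
  obtain ⟨f, hf⟩ : ∃ f, B e f = 1 := by
    by_contra! H
    refine he (hn e fun y => ?_)
    by_contra hy
    exact H ((B e y)⁻¹ • y) (by simp [hy])
  have hfe : B f e = -1 := by rw [swap, hf]
  let U : Submodule ℝ V := LinearMap.ker (B e) ⊓ LinearMap.ker (B f)
  have hU : ∀ {x}, x ∈ U ↔ B e x = 0 ∧ B f x = 0 := by
    intro x; simp [U]
  -- The projection onto `U` along the plane of `e` and `f`.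
  let p₀ : V →ₗ[ℝ] V := LinearMap.id - ((B.flip f).smulRight e) - ((B e).smulRight f)
  have hp₀ : ∀ x, p₀ x = x - B x f • e - B e x • f := fun x => by simp [p₀]
  have hp₀U : ∀ x, p₀ x ∈ U := by
    intro x
    rw [hU, hp₀]
    constructor
    · simp [hf, self]
    · simp [hfe, self, swap x f]
  let p : V →ₗ[ℝ] U := p₀.codRestrict U hp₀U
  have hp : ∀ x, x = B x f • e + B e x • f + (p x : V) := fun x => by
    simp [p, hp₀]
  have hpU : ∀ u : U, p u = u := by
    intro u
    obtain ⟨h1, h2⟩ := hU.1 u.2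
    have h3 : B u f = 0 := by rw [swap, h2, neg_zero]
    ext
    simp [p, hp₀, h1, h3]
  have hpe : p e = 0 := by ext; simp [p, hp₀, hf, self]
  have hpf : p f = 0 := by ext; simp [p, hp₀, hf, self]
  have hlt : Module.finrank ℝ U < n := by
    rw [← h]
    refine Submodule.finrank_lt fun hT => ?_
    have : f ∈ U := hT ▸ Submodule.mem_top
    rw [hU, hf] at this
    exact one_ne_zero this.1
  have hUr : ∀ u : U, B u e = 0 ∧ B u f = 0 := fun u => by
    obtain ⟨h1, h2⟩ := hU.1 u.2
    exact ⟨by rw [swap, h1, neg_zero], by rw [swap, h2, neg_zero]⟩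
  have hUl : ∀ u : U, B e u = 0 ∧ B f u = 0 := fun u => hU.1 u.2
  obtain ⟨J, J1, J2, J3⟩ := ih _ hlt (B.restrict U) (fun x => hB x) (by
    intro x hx
    have : (x : V) = 0 := by
      refine hn x fun y => ?_
      rw [hp y]
      have := hx (p y)
      simp only [LinearMap.BilinForm.restrict_apply, LinearMap.domRestrict_apply] at this
      simp [hUr x, this]
    exact Subtype.ext this) rfl
  have J2' : ∀ x y : U, B (J x) (J y) = B x y := J2
  have J3' : ∀ x : U, x ≠ 0 → 0 < B x (J x) := J3
  let K : V →ₗ[ℝ] V := (B.flip f).smulRight f - (B e).smulRight e + U.subtype ∘ₗ J ∘ₗ p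
  have hK : ∀ x, K x = B x f • f - B e x • e + (J (p x) : V) := fun x => by simp [K]
  refine ⟨K, fun x => ?_, fun x y => ?_, fun x hx => ?_⟩
  · have hq : p (K x) = J (p x) := by
      rw [hK, map_add, map_sub, map_smul, map_smul, hpe, hpf, hpU]; simp
    rw [hK (K x), hq, J1, hK]
    simp only [map_add, map_sub, map_smul, LinearMap.add_apply, LinearMap.sub_apply,
      LinearMap.smul_apply, hf, self, hUl, hUr, smul_eq_mul, NegMemClass.coe_neg]
    conv_rhs => rw [hp x]
    module
  · have e1 := hK x
    have e2 := hK y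
    conv_rhs => rw [hp x, hp y]
    rw [e1, e2]
    simp only [map_add, map_sub, map_smul, LinearMap.add_apply, LinearMap.sub_apply,
      LinearMap.smul_apply, hf, hfe, self, hUl, hUr, smul_eq_mul, J2']
    ring
  · have e1 := hK x
    have key : B x (K x) = B x f ^ 2 + B e x ^ 2 + B (p x) (J (p x)) := by
      rw [e1]
      conv_lhs => rw [hp x]
      simp only [map_add, map_sub, map_smul, LinearMap.add_apply,
        LinearMap.smul_apply, hf, hfe, self, hUl, hUr, smul_eq_mul, hpU, hpe, hpf]
      simp
      ring
    rw [key]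
    by_cases h0 : p x = 0
    · rw [h0]
      have hx' := hp x
      rw [h0] at hx'
      have : ¬ (B x f = 0 ∧ B e x = 0) := by
        rintro ⟨h1, h2⟩
        rw [h1, h2] at hx'
        exact hx (by simpa using hx')
      simp only [map_zero, ZeroMemClass.coe_zero, add_zero]
      by_contra hcon
      exact this ⟨by nlinarith [sq_nonneg (B x f), sq_nonneg (B e x)],
        by nlinarith [sq_nonneg (B x f), sq_nonneg (B e x)]⟩
    · have := J3' _ h0
      positivity

theorem SymplecticForm.nonempty_compatible {V : Type*} [AddCommGroup V] [Module ℝ V]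
    [FiniteDimensional ℝ V] (ω : SymplecticForm V) : Nonempty (CompatibleComplexStructure ω) := by
  obtain ⟨J, h1, h2, h3⟩ :=
    LinearMap.BilinForm.IsAlt.exists_compatible ω.form ω.alt ω.nondegenerate.1
  exact ⟨⟨J, h1, h2, h3⟩⟩

namespace CompatibleComplexStructure

variable {V : Type*} [NormedAddCommGroup V] [NormedSpace ℝ V]
  {ω : SymplecticForm V} (C : CompatibleComplexStructure ω)

theorem form_J_comm (x y : V) : ω.form x (C.J y) = ω.form y (C.J x) := by
  rw [← C.symp x (C.J y), C.sq, map_neg, ← ω.form_swap]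

theorem form_J_left (x y : V) : ω.form (C.J x) y = -ω.form x (C.J y) := by
  rw [ω.form_swap, C.form_J_comm]

/-- The norm of the inner product `ω(x, J y)`. -/
def nrm (x : V) : ℝ := √(ω.form x (C.J x))

theorem nrm_sq (x : V) : C.nrm x ^ 2 = ω.form x (C.J x) := by
  refine Real.sq_sqrt ?_
  by_cases h : x = 0
  · simp [h]
  · exact (C.pos x h).le

theorem nrm_pos {x : V} (h : x ≠ 0) : 0 < C.nrm x := Real.sqrt_pos.2 (C.pos x h)

@[simp] theorem nrm_zero : C.nrm 0 = 0 := by simp [nrm]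

/-- Two nonzero vectors neither of which is a nonpositive multiple of the other. -/
def NotOpposite (x y : V) : Prop := 0 < C.nrm x * C.nrm y + ω.form x (C.J y)

variable {C}

theorem NotOpposite.left_ne {x y : V} (h : C.NotOpposite x y) : x ≠ 0 := by
  rintro rfl; simp [NotOpposite] at h

theorem NotOpposite.right_ne {x y : V} (h : C.NotOpposite x y) : y ≠ 0 := by
  rintro rfl; simp [NotOpposite] at h

/-- The strict case of Cauchy–Schwarz: the vector `|y| x + |x| y` is nonzero, and its square norm is
`2 |x| |y|` times the quantity that has to be positive. -/
theorem NotOpposite.of_forall {x y : V} (hx : x ≠ 0) (hy : y ≠ 0)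
    (h : ∀ r : ℝ, 0 < r → x ≠ -(r • y)) : C.NotOpposite x y := by
  have h1 := C.nrm_pos hx
  have h2 := C.nrm_pos hy
  by_cases hz : C.nrm y • x + C.nrm x • y = 0
  · refine (h (C.nrm x / C.nrm y) (by positivity) ?_).elim
    have : x + (C.nrm y)⁻¹ • C.nrm x • y = 0 := by
      have := congrArg (fun z => (C.nrm y)⁻¹ • z) hz
      simpa [smul_smul, h2.ne'] using this
    rw [eq_neg_iff_add_eq_zero, div_eq_inv_mul, ← smul_smul]
    exact this
  · have := C.pos _ hz
    simp only [map_add, map_smul, LinearMap.add_apply, LinearMap.smul_apply, smul_eq_mul] at this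
    rw [← C.nrm_sq, ← C.nrm_sq, C.form_J_comm y x] at this
    have e : C.nrm y * (C.nrm y * C.nrm x ^ 2) + C.nrm y * (C.nrm x * ω.form x (C.J y))
      + (C.nrm x * (C.nrm y * ω.form x (C.J y)) + C.nrm x * (C.nrm x * C.nrm y ^ 2))
      = 2 * (C.nrm x * C.nrm y) * (C.nrm x * C.nrm y + ω.form x (C.J y)) := by ring
    unfold NotOpposite
    have h3 : 0 < 2 * (C.nrm x * C.nrm y) := by positivity
    refine pos_of_mul_pos_right (a := 2 * (C.nrm x * C.nrm y)) ?_ h3.le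
    rw [← e]
    linarith

variable (C)

/-- The midpoint direction of `x` and `y`, rotated by `J`. -/
def pivot (x y : V) : V := C.J (C.nrm y • x + C.nrm x • y)

variable {C}

theorem NotOpposite.form_pivot_left {x y : V} (h : C.NotOpposite x y) :
    ω.form x (C.pivot x y) ≠ 0 := by
  have h1 := C.nrm_pos h.left_ne
  have : ω.form x (C.pivot x y) = C.nrm x * (C.nrm x * C.nrm y + ω.form x (C.J y)) := by
    simp only [pivot, map_add, map_smul, smul_eq_mul, ← C.nrm_sq]; ring
  rw [this]
  exact (mul_pos h1 h).ne'

theorem NotOpposite.form_pivot_right {x y : V} (h : C.NotOpposite x y) :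
    ω.form y (C.pivot x y) ≠ 0 := by
  have h1 := C.nrm_pos h.right_ne
  have : ω.form y (C.pivot x y) = C.nrm y * (C.nrm x * C.nrm y + ω.form x (C.J y)) := by
    simp only [pivot, map_add, map_smul, smul_eq_mul, ← C.nrm_sq, C.form_J_comm y x]; ring
  rw [this]
  exact (mul_pos h1 h).ne'

variable (C) [FiniteDimensional ℝ V]

@[fun_prop]
theorem continuous_J {P : Type*} [TopologicalSpace P] {x : P → V} (hx : Continuous x) :
    Continuous fun p => C.J (x p) :=
  (LinearMap.continuous_of_finiteDimensional C.J).comp hx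

@[fun_prop]
theorem continuous_nrm {P : Type*} [TopologicalSpace P] {x : P → V} (hx : Continuous x) :
    Continuous fun p => C.nrm (x p) := by
  unfold nrm; fun_prop

/-- A symplectic map that takes `x` to `y`, through `pivot x y`. -/
def carry (x y : V) : Sp ω :=
  transvection ω (y - C.pivot x y) (ω.form y (C.pivot x y))⁻¹ *
    transvection ω (C.pivot x y - x) (ω.form (C.pivot x y) x)⁻¹

variable {C}

/-- One transvection along `y - x` would need `ω(y, x) ≠ 0`, which fails at `y = x`. The pivot pairs
nontrivially with both vectors, so the detour `x ↦ pivot ↦ y` is available whenever they are not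
opposite. -/
theorem NotOpposite.carry_app {x y : V} (h : C.NotOpposite x y) :
    Sp.app (C.carry x y) x = y := by
  have h1 := h.form_pivot_left
  have h2 := h.form_pivot_right
  rw [carry, Sp.app_mul]
  set n := C.pivot x y
  have h3 : ω.form n x ≠ 0 := by rwa [ω.form_swap, neg_ne_zero]
  have e1 : Sp.app (transvection ω (n - x) (ω.form n x)⁻¹) x = n := by
    simp [h3]
  rw [e1]
  simp [h2]

variable (C)

/-- For `y = x` the two transvections are inverse to each other. This keeps the correcting factors
of the homotopies trivial where nothing has to move. -/
theorem carry_self (x : V) : C.carry x x = 1 := by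
  rw [carry, ← transvection_neg, neg_sub]
  refine transvection_mul_neg _ _ _ ?_
  rw [ω.form_swap, inv_neg]

theorem continuous_carry {P : Type*} [TopologicalSpace P] {x y : P → V} (hx : Continuous x)
    (hy : Continuous y) (h : ∀ p, C.NotOpposite (x p) (y p)) :
    Continuous fun p => C.carry (x p) (y p) := by
  have hn : Continuous fun p => C.pivot (x p) (y p) := by unfold pivot; fun_prop
  have h1 : Continuous fun p => (ω.form (y p) (C.pivot (x p) (y p)))⁻¹ :=
    (ω.continuous_form hy hn).inv₀ fun p => (h p).form_pivot_right
  have h2 : Continuous fun p => (ω.form (C.pivot (x p) (y p)) (x p))⁻¹ :=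
    (ω.continuous_form hn hx).inv₀ fun p => by
      rw [ω.form_swap, neg_ne_zero]; exact (h p).form_pivot_left
  unfold carry
  fun_prop

theorem transvection_app_of_form_eq_zero {a w : V} (s : ℝ) (h : ω.form a w = 0) :
    Sp.app (transvection ω a s) w = w := by simp [h]

/-- Since `W` is `J`-stable, the pivot is also orthogonal to `W`, so both transvections go along
vectors orthogonal to `W`. -/
theorem carry_app_of_mem {W : Submodule ℝ V} (hW : ∀ w ∈ W, C.J w ∈ W) {x y w : V}
    (hx : x ∈ ω.form.orthogonal W) (hy : y ∈ ω.form.orthogonal W) (hw : w ∈ W) :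
    Sp.app (C.carry x y) w = w := by
  rw [LinearMap.BilinForm.mem_orthogonal_iff] at hx hy
  have hx' : ω.form x w = 0 := by rw [ω.form_swap, hx w hw, neg_zero]
  have hy' : ω.form y w = 0 := by rw [ω.form_swap, hy w hw, neg_zero]
  have hn : ω.form (C.pivot x y) w = 0 := by
    rw [ω.form_swap, neg_eq_zero, pivot]
    have h1 := hx _ (hW w hw)
    have h2 := hy _ (hW w hw)
    rw [C.form_J_left, neg_eq_zero] at h1 h2
    simp [h1, h2]
  rw [carry, Sp.app_mul, transvection_app_of_form_eq_zero (w := w) _ (by simp [hx', hn]),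
    transvection_app_of_form_eq_zero _ (by simp [hy', hn])]

end CompatibleComplexStructure

/-- A loop of nonzero vectors in a space of dimension at least `3` is close to one that avoids a
line. -/
theorem exists_near_avoiding_line {U : Type*} [NormedAddCommGroup U] [NormedSpace ℝ U]
    [FiniteDimensional ℝ U] (hU : 2 < Module.finrank ℝ U) {v : I → U} (hv : Continuous v)
    (h0 : ∀ s, v s ≠ 0) {e : U} (v0 : v 0 = e) (v1 : v 1 = e) :
    ∃ w : I → U, Continuous w ∧ w 0 = e ∧ w 1 = e ∧ (∀ s, ‖w s - v s‖ < ‖v s‖) ∧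
      ∃ q : U, ∀ (r : ℝ) (s : I), r • w s ≠ q := by
  obtain ⟨s₀, -, hs₀⟩ := isCompact_univ.exists_isMinOn (Set.univ_nonempty (α := I))
    hv.norm.continuousOn
  have hs₀ : ∀ s, ‖v s₀‖ ≤ ‖v s‖ := fun s => hs₀ (Set.mem_univ s)
  -- Smoothing costs at most `ε`, and restoring the endpoints costs at most another `ε`; the total
  -- stays below the minimum `4ε` of `‖v‖`.
  set ε := ‖v s₀‖ / 4 with hε
  have ε0 : 0 < ε := div_pos (norm_pos_iff.2 (h0 s₀)) (by norm_num)
  have huc : UniformContinuous (Set.IccExtend zero_le_one v) :=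
    (CompactSpace.uniformContinuous_of_continuous hv).comp
      (LipschitzWith.projIcc zero_le_one).uniformContinuous
  obtain ⟨g, hg, hgv⟩ := huc.exists_contDiff_dist_le ε0
  have hgv : ∀ s : I, ‖g s - v s‖ < ε := fun s => by
    have := hgv s
    rwa [Set.IccExtend_val, dist_eq_norm] at this
  have hg : ContDiff ℝ 1 g := hg.of_le (by exact_mod_cast le_top)
  let w : ℝ → U := fun t => g t + (1 - t) • (e - g 0) + t • (e - g 1)
  have hw : ContDiff ℝ 1 w := by fun_prop
  -- The cone over the curve is a `C¹` image of `ℝ²`, so its complement is dense in dimension above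
  -- `2`.
  obtain ⟨q, hq⟩ := (ContDiff.dense_compl_range_of_finrank_lt_finrank
    (f := fun p : ℝ × ℝ => p.1 • w p.2) (contDiff_fst.smul (hw.comp contDiff_snd))
    (by simpa using hU)).nonempty
  refine ⟨fun s => w s, hw.continuous.comp continuous_subtype_val, by simp [w], by simp [w],
    fun s => ?_, q, fun r s h => hq ⟨(r, s), h⟩⟩
  have e0 : ‖e - g 0‖ < ε := by
    rw [← v0, norm_sub_rev]; exact_mod_cast hgv 0
  have e1 : ‖e - g 1‖ < ε := by
    rw [← v1, norm_sub_rev]; exact_mod_cast hgv 1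
  have t0 : 0 ≤ (s : ℝ) := s.2.1
  have t1 : 0 ≤ 1 - (s : ℝ) := sub_nonneg.2 s.2.2
  calc ‖w s - v s‖ = ‖(g s - v s) + (1 - (s : ℝ)) • (e - g 0) + (s : ℝ) • (e - g 1)‖ := by
        congr 1; simp only [w]; abel
    _ ≤ ‖g s - v s‖ + (1 - (s : ℝ)) * ‖e - g 0‖ + s * ‖e - g 1‖ := by
        refine (norm_add₃_le).trans_eq ?_
        rw [norm_smul, norm_smul, Real.norm_of_nonneg t0, Real.norm_of_nonneg t1]
    _ ≤ ε + (1 - (s : ℝ)) * ε + s * ε := by gcongr; exact (hgv s).le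
    _ < ‖v s₀‖ := by rw [hε]; nlinarith [norm_pos_iff.2 (h0 s₀)]
    _ ≤ ‖v s‖ := hs₀ s

/-! ### Deforming the image of a vector under a loop -/

namespace CompatibleComplexStructure

variable {V : Type*} [NormedAddCommGroup V] [NormedSpace ℝ V]
  {ω : SymplecticForm V} (C : CompatibleComplexStructure ω)

open UniversalCover LinearMap.BilinForm

/-- The path fixes all vectors of `W`. -/
def FixesOn (W : Submodule ℝ V) (γ : PathsFrom (Sp ω) 1) : Prop :=
  ∀ s, ∀ w ∈ W, Sp.app (γ.1 s) w = w

theorem FixesOn.app_mem {W : Submodule ℝ V} {γ : PathsFrom (Sp ω) 1} (h : FixesOn W γ) (s : I)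
    {x : V} (hx : x ∈ ω.form.orthogonal W) : Sp.app (γ.1 s) x ∈ ω.form.orthogonal W := by
  rw [mem_orthogonal_iff] at hx ⊢
  intro w hw
  have := Sp.form_app (γ.1 s) w x
  rw [h s w hw] at this
  exact this.trans (hx w hw)

variable {C}

/-- The open ball of radius `‖x‖` about `x` is convex and contains no nonpositive multiple of `x`.
This holds for any norm, so the ambient one need not be the one of `J`. -/
theorem NotOpposite.of_norm_sub_lt {x y : V} (h : ‖y - x‖ < ‖x‖) (u : I) :
    C.NotOpposite x ((1 - (u : ℝ)) • x + (u : ℝ) • y) := by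
  have key : ∀ r : ℝ, 0 ≤ r → (1 + r) • x + (r * u) • (y - x) ≠ 0 ∧ x + (u : ℝ) • (y - x) ≠ 0 := by
    intro r hr
    have h0 := u.2.1
    have h1 := u.2.2
    have hx : 0 < ‖x‖ := (norm_nonneg _).trans_lt h
    constructor
    · intro h2
      have h3 := congrArg norm (eq_neg_of_add_eq_zero_left h2)
      rw [norm_neg, norm_smul, norm_smul, Real.norm_of_nonneg (by positivity),
        Real.norm_of_nonneg (by positivity)] at h3
      have : r * u * ‖y - x‖ ≤ r * 1 * ‖x‖ := by gcongr
      linarith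
    · intro h2
      have h3 := congrArg norm (eq_neg_of_add_eq_zero_left h2)
      rw [norm_neg, norm_smul, Real.norm_of_nonneg h0] at h3
      have : u * ‖y - x‖ ≤ 1 * ‖y - x‖ := by gcongr
      linarith
  have e : (1 - (u : ℝ)) • x + (u : ℝ) • y = x + (u : ℝ) • (y - x) := by module
  rw [e]
  refine NotOpposite.of_forall ?_ (key 0 le_rfl).2 ?_
  · rintro rfl
    simp only [norm_zero] at h
    exact absurd h (norm_nonneg _).not_gt
  · intro r hr h2
    refine (key r hr.le).1 ?_
    rw [eq_neg_iff_add_eq_zero] at h2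
    rw [← h2]; module

theorem NotOpposite.smul_self {x : V} (hx : x ≠ 0) {r : ℝ} (hr : 0 < r) :
    C.NotOpposite x (r • x) := by
  refine NotOpposite.of_forall hx (smul_ne_zero hr.ne' hx) fun s hs h => ?_
  have : (1 + s * r) • x = 0 := by
    rw [eq_neg_iff_add_eq_zero] at h
    rw [← h]; module
  rcases smul_eq_zero.1 this with h1 | h1
  · nlinarith
  · exact hx h1

/-- If a point of the segment from `q` to `x` lay on the closed ray opposite to `q`, then so would
`x`. -/
theorem NotOpposite.lineMap_left {x q : V} (hq : q ≠ 0) (h : ∀ r : ℝ, 0 ≤ r → x ≠ -(r • q))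
    (u : I) : C.NotOpposite ((1 - (u : ℝ)) • q + (u : ℝ) • x) q := by
  have h0 := u.2.1
  have h1 := u.2.2
  have key : ∀ r : ℝ, 0 ≤ r → (1 - (u : ℝ)) • q + (u : ℝ) • x ≠ -(r • q) := by
    intro r hr h2
    have h3 : (u : ℝ) • x = -((1 - u + r) • q) := by
      rw [eq_neg_iff_add_eq_zero] at h2 ⊢
      rw [← h2]; module
    rcases eq_or_lt_of_le h0 with hu | hu
    · rw [← hu] at h3
      have : (1 - 0 + r) • q = 0 := by simpa using h3.symm
      rcases smul_eq_zero.1 this with h4 | h4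
      · linarith
      · exact hq h4
    · refine h ((u : ℝ)⁻¹ * (1 - u + r)) (mul_nonneg (inv_nonneg.2 h0) (by linarith)) ?_
      have := congrArg (fun z => (u : ℝ)⁻¹ • z) h3
      simpa [smul_smul, hu.ne'] using this
  refine NotOpposite.of_forall (by simpa using key 0 le_rfl) hq fun r hr => key r hr.le

variable (C) [FiniteDimensional ℝ V]

/-- The image of a vector under a loop can be deformed, as long as it is never turned to the
opposite direction. -/
theorem exists_loop_app_eq {W : Submodule ℝ V} (hW : ∀ w ∈ W, C.J w ∈ W)
    {γ : PathsFrom (Sp ω) 1} (h1 : γ.1 1 = 1) (hγ : FixesOn W γ) {e : V}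
    (he : e ∈ ω.form.orthogonal W) {w : I → V} (hc : Continuous w) (w0 : w 0 = e) (w1 : w 1 = e)
    (hw : ∀ s, w s ∈ ω.form.orthogonal W)
    (h : ∀ u s : I, C.NotOpposite (Sp.app (γ.1 s) e)
      ((1 - (u : ℝ)) • Sp.app (γ.1 s) e + (u : ℝ) • w s)) :
    ∃ δ : PathsFrom (Sp ω) 1, UniversalCover.mk γ = UniversalCover.mk δ ∧ δ.1 1 = 1 ∧ FixesOn W δ ∧
      ∀ s, Sp.app (δ.1 s) e = w s := by
  have h' : ∀ s, C.NotOpposite (Sp.app (γ.1 s) e) (w s) := fun s => by simpa using h 1 s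
  let α : I × I → Sp ω := fun p => C.carry (Sp.app (γ.1 p.2) e)
    ((1 - (p.1 : ℝ)) • Sp.app (γ.1 p.2) e + (p.1 : ℝ) • w p.2)
  have hα : Continuous α := C.continuous_carry (by fun_prop) (by fun_prop) fun p => h _ _
  have α0 : ∀ s, α (0, s) = 1 := fun s => by simp [α, carry_self]
  have αl : ∀ u, α (u, 0) = 1 := fun u => by
    simp only [α, w0, γ.2, Sp.app_one, ← add_smul, sub_add_cancel, one_smul, carry_self]
  have αr : ∀ u, α (u, 1) = 1 := fun u => by
    simp only [α, w1, h1, Sp.app_one, ← add_smul, sub_add_cancel, one_smul, carry_self]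
  have α1 : ∀ s, α (1, s) = C.carry (Sp.app (γ.1 s) e) (w s) := fun s => by simp [α]
  refine ⟨⟨⟨fun s => α (1, s) * γ.1 s, by fun_prop⟩, by simp [αl, γ.2]⟩,
    mk_eq_mk_of_mul_homotopy α hα α0 (fun s => rfl) αl αr, by simp [αr, h1], ?_, ?_⟩
  · intro s x hx
    change Sp.app (α (1, s) * γ.1 s) x = x
    rw [α1, Sp.app_mul, hγ s x hx, C.carry_app_of_mem hW (hγ.app_mem s he) (hw s) hx]
  · intro s
    change Sp.app (α (1, s) * γ.1 s) e = w s
    rw [α1, Sp.app_mul, (h' s).carry_app]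

/-- If the image of `e` under a loop avoids a ray, then the loop can be deformed into the stabilizer
of `e`. -/
theorem exists_loop_app_eq_self {W : Submodule ℝ V} (hW : ∀ w ∈ W, C.J w ∈ W)
    {γ : PathsFrom (Sp ω) 1} (h1 : γ.1 1 = 1) (hγ : FixesOn W γ) {e q : V}
    (he : e ∈ ω.form.orthogonal W) (hq : q ∈ ω.form.orthogonal W) (hq0 : q ≠ 0)
    (h : ∀ s, ∀ r : ℝ, 0 ≤ r → Sp.app (γ.1 s) e ≠ -(r • q)) :
    ∃ δ : PathsFrom (Sp ω) 1, UniversalCover.mk γ = UniversalCover.mk δ ∧ δ.1 1 = 1 ∧ FixesOn W δ ∧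
      ∀ s, Sp.app (δ.1 s) e = e := by
  have h0 : ∀ r : ℝ, 0 ≤ r → e ≠ -(r • q) := by simpa [γ.2] using h 0
  let y : I × V → V := fun p => (1 - (p.1 : ℝ)) • q + (p.1 : ℝ) • p.2
  -- At `u = 0` both factors are `carry q q = 1`; at `u = 1` the product takes the image of `e` to
  -- `q` and then back to `e`. The inverse factor makes `α` trivial at the ends of the loop, where
  -- the image of `e` is `e` itself.
  let α : I × I → Sp ω := fun p =>
    (C.carry (y (p.1, e)) q)⁻¹ * C.carry (y (p.1, Sp.app (γ.1 p.2) e)) q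
  have hα : Continuous α := by
    refine Continuous.mul (Continuous.inv ?_) ?_
    · exact C.continuous_carry (by fun_prop) (by fun_prop)
        fun p => NotOpposite.lineMap_left hq0 h0 _
    · exact C.continuous_carry (by fun_prop) (by fun_prop)
        fun p => NotOpposite.lineMap_left hq0 (h _) _
  have α0 : ∀ s, α (0, s) = 1 := fun s => by simp [α, y]
  have αl : ∀ u, α (u, 0) = 1 := fun u => by simp [α, γ.2]
  have αr : ∀ u, α (u, 1) = 1 := fun u => by simp [α, h1]
  have α1 : ∀ s, α (1, s) = (C.carry e q)⁻¹ * C.carry (Sp.app (γ.1 s) e) q := fun s => by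
    simp [α, y]
  refine ⟨⟨⟨fun s => α (1, s) * γ.1 s, by fun_prop⟩, by simp [αl, γ.2]⟩,
    mk_eq_mk_of_mul_homotopy α hα α0 (fun s => rfl) αl αr, by simp [αr, h1], ?_, ?_⟩
  · intro s x hx
    change Sp.app (α (1, s) * γ.1 s) x = x
    rw [α1, Sp.app_mul, hγ s x hx, Sp.app_mul, C.carry_app_of_mem hW (hγ.app_mem s he) hq hx,
      Sp.app_inv_eq _ (C.carry_app_of_mem hW he hq hx)]
  · intro s
    have n1 : C.NotOpposite e q := by simpa using NotOpposite.lineMap_left (C := C) hq0 h0 1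
    have n2 : C.NotOpposite (Sp.app (γ.1 s) e) q := by
      simpa using NotOpposite.lineMap_left (C := C) hq0 (h s) 1
    change Sp.app (α (1, s) * γ.1 s) e = e
    rw [α1, Sp.app_mul, Sp.app_mul, n2.carry_app]
    have := Sp.app_inv_app (C.carry e q) e
    rwa [n1.carry_app] at this

end CompatibleComplexStructure

/-! ### Shears, plane rotations and the reduction of loops -/

namespace CompatibleComplexStructure

variable {V : Type*} [NormedAddCommGroup V] [NormedSpace ℝ V] [FiniteDimensional ℝ V]
  {ω : SymplecticForm V} (C : CompatibleComplexStructure ω)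

open UniversalCover LinearMap.BilinForm

/-- For `ω(e, d) = 0` and `ω(e, f) = 1`, a symplectic map that fixes `e` and takes `f` to
`f + d`. -/
def shear (ω : SymplecticForm V) (e f d : V) : Sp ω :=
  transvection ω (e + d) 1 * transvection ω e (-1 - ω.form d f) * transvection ω d (-1)

/-- Polarization: since `ω(e, d) = 0` the three transvections commute, and `T_{e+d}(1) T_e(-1)
T_d(-1)` leaves only the cross terms. The additional parameter `-ω(d, f)` at `e` removes the
component along `e` of the image of `f`. -/
theorem shear_app {e f d : V} (hd : ω.form e d = 0) (x : V) :
    Sp.app (shear ω e f d) x =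
      x + ω.form e x • d + ω.form d x • e - (ω.form d f * ω.form e x) • e := by
  have hd' : ω.form d e = 0 := by rw [ω.form_swap, hd, neg_zero]
  simp only [shear, Sp.app_mul, Sp.app_transvection, map_add, map_smul, LinearMap.add_apply, hd,
    hd', ω.form_self, smul_eq_mul]
  module

@[simp] theorem shear_zero (e f : V) : shear ω e f 0 = 1 :=
  Sp.ext_app fun x => by simp [shear_app]

theorem continuous_shear (e f : V) {P : Type*} [TopologicalSpace P] {d : P → V}
    (hd : Continuous d) : Continuous fun p => shear ω e f (d p) := by
  unfold shear; fun_prop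

/-- A loop that fixes `e` can be deformed into a loop that fixes `J e` as well. -/
theorem exists_loop_app_eq_self_of_app_eq_self {W : Submodule ℝ V} (hW : ∀ w ∈ W, C.J w ∈ W)
    {γ : PathsFrom (Sp ω) 1} (h1 : γ.1 1 = 1) (hγ : FixesOn W γ) {e : V}
    (he : e ∈ ω.form.orthogonal W) (hee : ω.form e (C.J e) = 1)
    (hfix : ∀ s, Sp.app (γ.1 s) e = e) :
    ∃ δ : PathsFrom (Sp ω) 1, UniversalCover.mk γ = UniversalCover.mk δ ∧ δ.1 1 = 1 ∧
      FixesOn W δ ∧ ∀ s, Sp.app (δ.1 s) e = e ∧ Sp.app (δ.1 s) (C.J e) = C.J e := by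
  have hf : C.J e ∈ ω.form.orthogonal W := by
    rw [mem_orthogonal_iff] at he ⊢
    intro w hw
    have := he _ (hW w hw)
    rwa [C.form_J_left, neg_eq_zero] at this
  set f := C.J e
  let d : I → V := fun s => Sp.app (γ.1 s) f - f
  have hd : ∀ s, ω.form e (d s) = 0 := fun s => by
    have := Sp.form_app (γ.1 s) e f
    rw [hfix] at this
    simp [d, this]
  have hdW : ∀ s, ∀ w ∈ W, ω.form (d s) w = 0 := fun s w hw => by
    have := Submodule.sub_mem _ (hγ.app_mem s hf) hf
    rw [mem_orthogonal_iff] at this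
    rw [ω.form_swap, neg_eq_zero]
    exact this w hw
  have heW : ∀ w ∈ W, ω.form e w = 0 := fun w hw => by
    rw [mem_orthogonal_iff] at he
    rw [ω.form_swap, neg_eq_zero]
    exact he w hw
  -- The vectors `d` with `ω(e, d) = 0` form a linear space, so the displacement of `f` can be
  -- scaled down to `0` linearly.
  let α : I × I → Sp ω := fun p => (shear ω e f ((p.1 : ℝ) • d p.2))⁻¹
  have hα : Continuous α := (continuous_shear e f (by fun_prop)).inv
  have αl : ∀ u, α (u, 0) = 1 := fun u => by simp [α, d, γ.2]
  have αr : ∀ u, α (u, 1) = 1 := fun u => by simp [α, d, h1]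
  have α1 : ∀ s, α (1, s) = (shear ω e f (d s))⁻¹ := fun s => by simp [α]
  refine ⟨⟨⟨fun s => α (1, s) * γ.1 s, by fun_prop⟩, by simp [αl, γ.2]⟩,
    mk_eq_mk_of_mul_homotopy α hα (fun s => by simp [α]) (fun s => rfl) αl αr, by simp [αr, h1],
    ?_, fun s => ⟨?_, ?_⟩⟩
  · intro s x hx
    change Sp.app (α (1, s) * γ.1 s) x = x
    rw [α1, Sp.app_mul, hγ s x hx]
    refine Sp.app_inv_eq _ ?_
    rw [shear_app (hd s), hdW s x hx, heW x hx]
    simp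
  · change Sp.app (α (1, s) * γ.1 s) e = e
    rw [α1, Sp.app_mul, hfix]
    refine Sp.app_inv_eq _ ?_
    have hd' : ω.form (d s) e = 0 := by rw [ω.form_swap, hd, neg_zero]
    rw [shear_app (hd s), hd']
    simp
  · change Sp.app (α (1, s) * γ.1 s) f = f
    rw [α1, Sp.app_mul]
    have : Sp.app (shear ω e f (d s)) f = Sp.app (γ.1 s) f := by
      rw [shear_app (hd s), hee]
      simp [d]
    rw [← this, Sp.app_inv_app]

/-- The component of `x` in the plane spanned by `e` and `J e`, for `e` of norm `1`. -/
def planeProj (e x : V) : V := ω.form x (C.J e) • e + ω.form e x • C.J e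

/-- The rotation by the angle `θ` in the plane spanned by `e` and `J e`, as a
function. -/
def rotFun (e : V) (θ : ℝ) (x : V) : V :=
  x + (Real.cos θ - 1) • C.planeProj e x + Real.sin θ • C.J (C.planeProj e x)

theorem rotFun_eq (e : V) (θ : ℝ) (x : V) : C.rotFun e θ x =
    x + ((Real.cos θ - 1) * ω.form x (C.J e) - Real.sin θ * ω.form e x) • e +
      ((Real.cos θ - 1) * ω.form e x + Real.sin θ * ω.form x (C.J e)) • C.J e := by
  simp only [rotFun, planeProj, map_add, map_smul, C.sq]
  module

/-- The rotation by the angle `θ` in the plane spanned by `e` and `J e`, as a linear map. -/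
def rotLin (e : V) (θ : ℝ) : V →L[ℝ] V := LinearMap.toContinuousLinearMap
  { toFun := C.rotFun e θ
    map_add' := fun x y => by
      simp only [rotFun_eq, map_add, LinearMap.add_apply]; module
    map_smul' := fun r x => by
      simp only [rotFun_eq, map_smul, LinearMap.smul_apply, smul_eq_mul, RingHom.id_apply]
      module }

theorem rotLin_apply (e : V) (θ : ℝ) (x : V) : C.rotLin e θ x =
    x + ((Real.cos θ - 1) * ω.form x (C.J e) - Real.sin θ * ω.form e x) • e +
      ((Real.cos θ - 1) * ω.form e x + Real.sin θ * ω.form x (C.J e)) • C.J e :=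
  C.rotFun_eq e θ x

variable {C}

theorem rotLin_mul {e : V} (he : ω.form e (C.J e) = 1) (θ φ : ℝ) :
    C.rotLin e θ * C.rotLin e φ = C.rotLin e (θ + φ) := by
  ext x
  have he' : ω.form (C.J e) e = -1 := by rw [ω.form_swap, he]
  change C.rotLin e θ (C.rotLin e φ x) = _
  simp only [rotLin_apply, map_add, map_smul, he,
    ω.form_self, Real.cos_add, Real.sin_add]
  module

@[simp] theorem rotLin_zero (e : V) : C.rotLin e 0 = 1 := by
  ext x; simp [rotLin_apply]

/-- The rotation by the angle `θ` in the plane spanned by `e` and `J e`, where `e` has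
norm `1`. -/
def rot {e : V} (he : ω.form e (C.J e) = 1) (θ : ℝ) : Sp ω :=
  ⟨{ val := C.rotLin e θ
     inv := C.rotLin e (-θ)
     val_inv := by rw [rotLin_mul he]; simp
     inv_val := by rw [rotLin_mul he]; simp }, by
    intro x y
    have he' : ω.form (C.J e) e = -1 := by rw [ω.form_swap, he]
    have h1 : ω.form (C.J e) y = -ω.form y (C.J e) := ω.form_swap _ _
    have h2 : ω.form x e = -ω.form e x := ω.form_swap _ _
    simp only [rotLin_apply, map_add, map_smul, LinearMap.add_apply, LinearMap.smul_apply, he, he',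
      ω.form_self, smul_eq_mul, h1, h2]
    linear_combination (ω.form x (C.J e) * ω.form e y - ω.form e x * ω.form y (C.J e)) *
      Real.sin_sq_add_cos_sq θ⟩

variable {e : V} (he : ω.form e (C.J e) = 1)

theorem rot_app (θ : ℝ) (x : V) : Sp.app (rot he θ) x =
    x + ((Real.cos θ - 1) * ω.form x (C.J e) - Real.sin θ * ω.form e x) • e +
      ((Real.cos θ - 1) * ω.form e x + Real.sin θ * ω.form x (C.J e)) • C.J e :=
  C.rotLin_apply e θ x

theorem rot_inv (θ : ℝ) : (rot he θ)⁻¹ = rot he (-θ) := Subtype.ext (Units.ext rfl)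

@[simp] theorem rot_zero : rot he 0 = 1 := Sp.ext_app fun x => by simp [rot_app]

theorem rot_app_self (θ : ℝ) :
    Sp.app (rot he θ) e = Real.cos θ • e + Real.sin θ • C.J e := by
  rw [rot_app, he, ω.form_self]
  module

@[fun_prop]
theorem continuous_rot {P : Type*} [TopologicalSpace P] {θ : P → ℝ} (hθ : Continuous θ) :
    Continuous fun p => rot he (θ p) := by
  refine Sp.continuous_of_app (fun x => ?_) (fun x => ?_)
  · simp only [rot_app]; fun_prop
  · simp only [rot_inv, rot_app]; fun_prop

/-- The path of rotations by the angles `θ`. -/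
def rotPath (θ : C(I, ℝ)) (hθ : θ 0 = 0) : PathsFrom (Sp ω) 1 :=
  ⟨⟨fun s => rot he (θ s), by fun_prop⟩, by simp [hθ]⟩

/-- A loop in the symplectic group of the plane spanned by `e` and `J e` is homotopic to a loop of
rotations. -/
theorem exists_mk_eq_mk_rotPath {W : Submodule ℝ V} (hW : ∀ w ∈ W, C.J w ∈ W)
    {γ : PathsFrom (Sp ω) 1} (h1 : γ.1 1 = 1) (hγ : FixesOn W γ)
    (heW : e ∈ ω.form.orthogonal W)
    (hspan : ∀ x ∈ ω.form.orthogonal W, C.planeProj e x = x)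
    (htop : ∀ u : Sp ω, (∀ w ∈ W, Sp.app u w = w) → Sp.app u e = e → Sp.app u (C.J e) = C.J e →
      u = 1) :
    ∃ (θ : C(I, ℝ)) (hθ : θ 0 = 0), UniversalCover.mk γ = UniversalCover.mk (rotPath he θ hθ) := by
  have he0 : e ≠ 0 := by rintro rfl; simp at he
  let v : I → V := fun s => Sp.app (γ.1 s) e
  have hv : Continuous v := by fun_prop
  have hvW : ∀ s, v s ∈ ω.form.orthogonal W := fun s => hγ.app_mem s heW
  -- The complex coordinate of `v s` in the basis `e`, `J e`. Its lift `ζ` through `exp` has the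
  -- required angle as imaginary part.
  let z : C(I, {z : ℂ // z ≠ 0}) := ⟨fun s => ⟨⟨ω.form (v s) (C.J e), ω.form e (v s)⟩, fun h => by
      have h2 := hspan _ (hvW s)
      rw [planeProj, show ω.form (v s) (C.J e) = 0 from congrArg Complex.re h,
        show ω.form e (v s) = 0 from congrArg Complex.im h] at h2
      exact Sp.app_ne_zero (γ.1 s) he0 (by simpa using h2.symm)⟩, by
    refine Continuous.subtype_mk ?_ _
    have : Continuous fun s => Complex.equivRealProdCLM.symm
        (ω.form (v s) (C.J e), ω.form e (v s)) := by fun_prop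
    exact this⟩
  have z0 : z 0 = ⟨Complex.exp 0, Complex.exp_ne_zero 0⟩ := by
    refine Subtype.ext (Complex.ext ?_ ?_)
    · simp [z, v, γ.2, he]
    · simp [z, v, γ.2]
  let ζ := Complex.isCoveringMap_exp.liftPath z 0 z0
  have hζ0 : ζ 0 = 0 := Complex.isCoveringMap_exp.liftPath_zero _ _ _
  have hζ : ∀ s, Complex.exp (ζ s) = z s := fun s =>
    congrArg Subtype.val (congrFun (Complex.isCoveringMap_exp.liftPath_lifts z 0 z0) s)
  let θ : C(I, ℝ) := ⟨fun s => (ζ s).im, by fun_prop⟩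
  have hθ : θ 0 = 0 := by simp [θ, hζ0]
  -- Rotating `e` gives `v` rescaled by a positive factor, so the deformation from `v` to `w` never
  -- meets an opposite direction.
  let w : I → V := fun s => Sp.app (rot he (θ s)) e
  have hw : ∀ s, w s = Real.exp (-(ζ s).re) • v s := by
    intro s
    have e1 : Real.exp (ζ s).re * Real.cos (θ s) = ω.form (v s) (C.J e) := by
      change _ * Real.cos (ζ s).im = _
      rw [← Complex.exp_re, hζ]; rfl
    have e2 : Real.exp (ζ s).re * Real.sin (θ s) = ω.form e (v s) := by
      change _ * Real.sin (ζ s).im = _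
      rw [← Complex.exp_im, hζ]; rfl
    have e3 : v s = Real.exp (ζ s).re • w s := by
      conv_lhs => rw [← hspan _ (hvW s)]
      rw [planeProj, ← e1, ← e2]
      simp only [w, rot_app_self]
      module
    rw [e3, smul_smul, ← Real.exp_add]; simp
  have hv1 : v 1 = e := by simp [v, h1]
  have hcos : Real.cos (θ 1) = Real.exp (-(ζ 1).re) := by
    have := congrArg (fun x => ω.form x (C.J e)) (hw 1)
    simpa [w, hv1, rot_app_self, he] using this
  have hsin : Real.sin (θ 1) = 0 := by
    have := congrArg (fun x => ω.form e x) (hw 1)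
    simpa [w, hv1, rot_app_self, he] using this
  -- The sine vanishes and the cosine is positive, being a value of `exp`.
  have hcos1 : Real.cos (θ 1) = 1 := by
    have := Real.exp_pos (-(ζ 1).re)
    rw [← hcos] at this
    nlinarith [Real.sin_sq_add_cos_sq (θ 1)]
  have hrot1 : rot he (θ 1) = 1 := Sp.ext_app fun x => by simp [rot_app, hcos1, hsin]
  have heW' : C.J e ∈ ω.form.orthogonal W := by
    rw [mem_orthogonal_iff] at heW ⊢
    intro w hw
    have := heW _ (hW w hw)
    rwa [C.form_J_left, neg_eq_zero] at this
  obtain ⟨γ₁, m1, l1, f1, a1⟩ := C.exists_loop_app_eq (w := w) hW h1 hγ heW (by fun_prop)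
    (by simp [w, hθ]) (by simp [w, hrot1])
    (fun s => by
      rw [hw]; exact Submodule.smul_mem _ _ (hvW s))
    (fun u s => by
      change C.NotOpposite (v s) ((1 - (u : ℝ)) • v s + (u : ℝ) • w s)
      rw [hw, smul_smul, ← add_smul]
      refine NotOpposite.smul_self (Sp.app_ne_zero _ he0) ?_
      have h0 := u.2.1
      have h1 := u.2.2
      have := Real.exp_pos (-(ζ s).re)
      rcases eq_or_lt_of_le h1 with h | h
      · rw [h]; linarith
      · have := mul_nonneg h0 this.le
        linarith)
  have hrotW : ∀ φ, ∀ x ∈ W, Sp.app (rot he φ) x = x := by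
    intro φ x hx
    rw [mem_orthogonal_iff] at heW heW'
    have e1 := heW x hx
    have e2 := heW' x hx
    rw [ω.form_swap, neg_eq_zero] at e1
    simp [rot_app, e1, e2]
  -- Removing the rotations leaves a loop that fixes `e`. It deforms to one that fixes `W`, `e` and
  -- `J e`, hence to the constant loop.
  let γ₂ : PathsFrom (Sp ω) 1 :=
    ⟨⟨fun s => (rot he (θ s))⁻¹ * γ₁.1 s, by fun_prop⟩, by simp [hθ, γ₁.2]⟩
  obtain ⟨γ₃, m3, -, f3, a3⟩ := C.exists_loop_app_eq_self_of_app_eq_self hW (γ := γ₂)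
    (by simp [γ₂, hrot1, l1])
    (fun s x hx => by
      change Sp.app ((rot he (θ s))⁻¹ * γ₁.1 s) x = x
      rw [Sp.app_mul, f1 s x hx, Sp.app_inv_eq _ (hrotW _ x hx)]) heW he
    (fun s => by
      change Sp.app ((rot he (θ s))⁻¹ * γ₁.1 s) e = e
      rw [Sp.app_mul, a1, Sp.app_inv_app])
  refine ⟨θ, hθ, m1.trans ?_⟩
  have e1 : UniversalCover.mk γ₂ = 1 :=
    m3.trans (mk_eq_one_of_forall fun s => htop _ (f3 s) (a3 s).1 (a3 s).2)
  have e2 : UniversalCover.mk γ₁ = UniversalCover.mk (rotPath he θ hθ) * UniversalCover.mk γ₂ :=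
    congrArg UniversalCover.mk (Subtype.ext (ContinuousMap.ext fun s =>
      (mul_inv_cancel_left (rot he (θ s)) (γ₁.1 s)).symm))
  rw [e2, e1]
  exact mul_one (UniversalCover.mk (rotPath he θ hθ))

/-- Every loop in the symplectic group is homotopic to a loop of rotations in a plane. -/
theorem exists_rotPath_of_fixesOn (C : CompatibleComplexStructure ω) (n : ℕ) {W : Submodule ℝ V}
    (hn : Module.finrank ℝ (ω.form.orthogonal W) = n) (hW : ∀ w ∈ W, C.J w ∈ W)
    {γ : PathsFrom (Sp ω) 1} (h1 : γ.1 1 = 1) (hγ : FixesOn W γ) :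
    UniversalCover.mk γ = 1 ∨ ∃ (e : V) (he : ω.form e (C.J e) = 1) (θ : C(I, ℝ)) (hθ : θ 0 = 0),
      UniversalCover.mk γ = UniversalCover.mk (rotPath he θ hθ) := by
  induction n using Nat.strong_induction_on generalizing W γ with
  | _ n ih =>
  have hJW : ∀ x ∈ ω.form.orthogonal W, C.J x ∈ ω.form.orthogonal W := by
    intro x hx
    rw [mem_orthogonal_iff] at hx ⊢
    intro w hw
    have := hx _ (hW w hw)
    rwa [C.form_J_left, neg_eq_zero] at this
  have hinf : ∀ x ∈ W, x ∈ ω.form.orthogonal W → x = 0 := by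
    intro x hx hx'
    by_contra h0
    have := C.pos x h0
    rw [mem_orthogonal_iff] at hx'
    have h2 : ω.form (C.J x) x = 0 := hx' _ (hW x hx)
    rw [C.form_J_left] at h2
    linarith
  -- A `J`-stable subspace meets its orthogonal complement only in `0`, as `ω(x, J x) > 0` for `x ≠
  -- 0`; the dimensions then add up.
  have hsup : W ⊔ ω.form.orthogonal W = ⊤ := by
    refine Submodule.eq_top_of_disjoint _ _ ?_ (Submodule.disjoint_def.2 hinf)
    have := finrank_orthogonal ω.nondegenerate W
    have := Submodule.finrank_le W
    omega
  by_cases hbot : ω.form.orthogonal W = ⊥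
  · left
    rw [hbot, sup_bot_eq] at hsup
    exact mk_eq_one_of_forall fun s => Sp.ext_app fun x => hγ s x (hsup ▸ Submodule.mem_top)
  obtain ⟨x, hxW, hx0⟩ := Submodule.exists_mem_ne_zero_of_ne_bot hbot
  let e := (C.nrm x)⁻¹ • x
  have heW : e ∈ ω.form.orthogonal W := Submodule.smul_mem _ _ hxW
  have he : ω.form e (C.J e) = 1 := by
    have := (C.nrm_pos hx0).ne'
    simp only [e, map_smul, LinearMap.smul_apply, smul_eq_mul, ← C.nrm_sq]
    field_simp
  have he' : ω.form (C.J e) e = -1 := by rw [ω.form_swap, he]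
  have he0 : e ≠ 0 := by intro h; simp [h] at he
  -- There is room to avoid a line exactly when the complement is larger than a plane.
  by_cases hdim : 2 < n
  · let v : I → ω.form.orthogonal W := fun s => ⟨Sp.app (γ.1 s) e, hγ.app_mem s heW⟩
    obtain ⟨w, wc, w0, w1, wv, q, hq⟩ := exists_near_avoiding_line (hn ▸ hdim) (v := v)
      (by fun_prop) (fun s h => Sp.app_ne_zero (γ.1 s) he0 (congrArg Subtype.val h))
      (e := ⟨e, heW⟩) (by simp [v, γ.2]) (by simp [v, h1])
    obtain ⟨γ₁, m1, l1, f1, a1⟩ := C.exists_loop_app_eq (w := fun s => (w s : V)) hW h1 hγ heW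
      (by fun_prop) (congrArg Subtype.val w0) (congrArg Subtype.val w1) (fun s => (w s).2)
      (fun u s => NotOpposite.of_norm_sub_lt (x := (v s : V)) (y := (w s : V)) (wv s) u)
    obtain ⟨γ₂, m2, l2, f2, a2⟩ := C.exists_loop_app_eq_self hW l1 f1 heW q.2
      -- The vector `q` is nonzero because the avoided multiples of `w` include `0`.
      (fun h => hq 0 0 (by rw [zero_smul]; exact Subtype.ext h.symm))
      (fun s r hr h => by
        rw [a1] at h
        have h' : w s = -(r • q) := Subtype.ext h
        rcases eq_or_lt_of_le hr with h3 | h3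
        · have hne : (w s : V) ≠ 0 := by rw [← a1]; exact Sp.app_ne_zero _ he0
          exact hne (by rw [h, ← h3]; simp)
        · refine hq (-r⁻¹) s ?_
          rw [h', smul_neg, neg_smul, neg_neg, smul_smul, inv_mul_cancel₀ h3.ne', one_smul])
    obtain ⟨γ₃, m3, l3, f3, a3⟩ := C.exists_loop_app_eq_self_of_app_eq_self hW l2 f2 heW he a2
    rw [m1, m2, m3]
    let P : Submodule ℝ V := Submodule.span ℝ {e, C.J e}
    have hle : ω.form.orthogonal (W ⊔ P) ≤ ω.form.orthogonal W := orthogonal_le le_sup_left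
    have hlt : ω.form.orthogonal (W ⊔ P) < ω.form.orthogonal W := by
      refine lt_of_le_of_ne hle fun h => ?_
      have h2 : e ∈ ω.form.orthogonal (W ⊔ P) := h ▸ heW
      rw [mem_orthogonal_iff] at h2
      have : ω.form (C.J e) e = 0 :=
        h2 (C.J e) (Submodule.mem_sup_right (Submodule.subset_span (by simp)))
      rw [he'] at this
      norm_num at this
    refine ih _ (hn ▸ Submodule.finrank_lt_finrank_of_lt hlt) rfl ?_ l3 ?_
    · intro y hy
      obtain ⟨a, ha, b, hb, rfl⟩ := Submodule.mem_sup.1 hy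
      obtain ⟨r, s, rfl⟩ := Submodule.mem_span_pair.1 hb
      rw [map_add]
      refine Submodule.add_mem_sup (hW a ha) (Submodule.mem_span_pair.2 ⟨-s, r, ?_⟩)
      simp only [map_add, map_smul, C.sq]
      module
    · intro t y hy
      obtain ⟨a, ha, b, hb, rfl⟩ := Submodule.mem_sup.1 hy
      obtain ⟨r, s, rfl⟩ := Submodule.mem_span_pair.1 hb
      simp only [Sp.app_add, Sp.app_smul, f3 t a ha, (a3 t).1, (a3 t).2]
  · right
    have hli : LinearIndependent ℝ ![e, C.J e] := by
      rw [LinearIndependent.pair_iff]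
      intro r s h
      constructor
      · have := congrArg (fun x => ω.form x (C.J e)) h
        simpa [he] using this
      · have := congrArg (fun x => ω.form e x) h
        simpa [he] using this
    have hspan : Submodule.span ℝ {e, C.J e} = ω.form.orthogonal W := by
      refine Submodule.eq_of_le_of_finrank_le ?_ ?_
      · rw [Submodule.span_le]
        rintro y (rfl | rfl)
        exacts [heW, hJW e heW]
      · have := finrank_span_eq_card hli
        rw [Matrix.range_cons, Matrix.range_cons, Matrix.range_empty, Set.union_empty] at this
        change Module.finrank ℝ (Submodule.span ℝ {e, C.J e}) = 2 at this
        omega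
    have hplane : ∀ x ∈ ω.form.orthogonal W, C.planeProj e x = x := by
      intro x hx
      rw [← hspan] at hx
      obtain ⟨r, s, rfl⟩ := Submodule.mem_span_pair.1 hx
      simp [planeProj, he]
    refine ⟨e, he, exists_mk_eq_mk_rotPath he hW h1 hγ heW hplane fun u hu h2 h3 => ?_⟩
    refine Sp.ext_app fun y => ?_
    obtain ⟨a, ha, b, hb, rfl⟩ := Submodule.mem_sup.1 (hsup ▸ Submodule.mem_top (x := y))
    rw [← hspan] at hb
    obtain ⟨r, s, rfl⟩ := Submodule.mem_span_pair.1 hb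
    simp only [Sp.app_add, Sp.app_smul, hu a ha, h2, h3, Sp.app_one]

theorem exists_rotPath (C : CompatibleComplexStructure ω) {γ : PathsFrom (Sp ω) 1}
    (h1 : γ.1 1 = 1) :
    UniversalCover.mk γ = 1 ∨ ∃ (e : V) (he : ω.form e (C.J e) = 1) (θ : C(I, ℝ)) (hθ : θ 0 = 0),
      UniversalCover.mk γ = UniversalCover.mk (rotPath he θ hθ) := by
  refine C.exists_rotPath_of_fixesOn _ (W := ⊥) rfl ?_ h1 ?_
  · intro w hw
    rw [(Submodule.mem_bot ℝ).1 hw]; simp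
  · intro s w hw
    rw [(Submodule.mem_bot ℝ).1 hw]; simp

end CompatibleComplexStructure

/-! ### The Maslov phase on the Lagrangian Grassmannian -/

namespace CompatibleComplexStructure

section ComplexCoordinates

variable {V : Type*} [AddCommGroup V] [Module ℝ V] {ω : SymplecticForm V}

/-- The complex scalar multiplication on `V` that is given by `J`. -/
def complexSMul (C : CompatibleComplexStructure ω) (z : ℂ) (x : V) : V := z.re • x + z.im • C.J x

theorem one_complexSMul (C : CompatibleComplexStructure ω) (x : V) : C.complexSMul 1 x = x := by
  simp [complexSMul]

theorem zero_complexSMul (C : CompatibleComplexStructure ω) (x : V) : C.complexSMul 0 x = 0 := by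
  simp [complexSMul]

theorem complexSMul_mul (C : CompatibleComplexStructure ω) (z w : ℂ) (x : V) :
    C.complexSMul (z * w) x = C.complexSMul z (C.complexSMul w x) := by
  simp only [complexSMul, map_add, map_smul, C.sq, Complex.mul_re, Complex.mul_im]
  module

theorem complexSMul_add (C : CompatibleComplexStructure ω) (z : ℂ) (x y : V) :
    C.complexSMul z (x + y) = C.complexSMul z x + C.complexSMul z y := by
  simp only [complexSMul, map_add]
  module

theorem add_complexSMul (C : CompatibleComplexStructure ω) (z w : ℂ) (x : V) :
    C.complexSMul (z + w) x = C.complexSMul z x + C.complexSMul w x := by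
  simp only [complexSMul, Complex.add_re, Complex.add_im]
  module

/-- The vector space `V`, with the complex scalar multiplication that is given by `J`. -/
def ComplexSpace (_C : CompatibleComplexStructure ω) : Type _ := V

instance (C : CompatibleComplexStructure ω) : AddCommGroup C.ComplexSpace :=
  inferInstanceAs (AddCommGroup V)

instance (C : CompatibleComplexStructure ω) : Module ℂ C.ComplexSpace where
  smul := C.complexSMul
  one_smul := C.one_complexSMul
  mul_smul := C.complexSMul_mul
  smul_zero z := show C.complexSMul z 0 = 0 by simp [complexSMul]
  smul_add := C.complexSMul_add
  add_smul := C.add_complexSMul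
  zero_smul := C.zero_complexSMul

/-- The identity of `V`, as a real linear equivalence to the complex vector space. -/
def toComplexSpace (C : CompatibleComplexStructure ω) : V ≃ₗ[ℝ] C.ComplexSpace where
  toFun x := x
  invFun x := x
  left_inv _ := rfl
  right_inv _ := rfl
  map_add' _ _ := rfl
  map_smul' r x := show r • x = C.complexSMul r x by simp [complexSMul]

theorem toComplexSpace_J (C : CompatibleComplexStructure ω) (x : V) :
    C.toComplexSpace (C.J x) = Complex.I • C.toComplexSpace x :=
  show C.J x = C.complexSMul Complex.I x by simp [complexSMul]

theorem exists_complexCoordinates [FiniteDimensional ℝ V] (C : CompatibleComplexStructure ω) :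
    ∃ Φ : V ≃ₗ[ℝ] (Fin (Module.finrank ℝ V / 2) → ℂ), ∀ x, Φ (C.J x) = Complex.I • Φ x := by
  have : FiniteDimensional ℝ C.ComplexSpace := C.toComplexSpace.finiteDimensional
  have : FiniteDimensional ℂ C.ComplexSpace := Module.Finite.right ℝ ℂ C.ComplexSpace
  have h1 := C.toComplexSpace.finrank_eq
  have h2 := finrank_real_of_complex C.ComplexSpace
  let b := Module.finBasisOfFinrankEq ℂ C.ComplexSpace
    (n := Module.finrank ℝ V / 2) (by omega)
  refine ⟨C.toComplexSpace.trans (b.equivFun.restrictScalars ℝ), fun x => ?_⟩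
  simp only [LinearEquiv.trans_apply, LinearEquiv.restrictScalars_apply, toComplexSpace_J,
    map_smul]

end ComplexCoordinates

variable {V : Type*} [NormedAddCommGroup V] [NormedSpace ℝ V]
  {ω : SymplecticForm V} {C : CompatibleComplexStructure ω}

variable (Φ : V ≃ₗ[ℝ] (Fin (Module.finrank ℝ V / 2) → ℂ))

/-- The complex matrix of a frame. -/
def frameMatrix (f : (Fin (Module.finrank ℝ V / 2) → ℝ) →L[ℝ] V) :
    Matrix (Fin (Module.finrank ℝ V / 2)) (Fin (Module.finrank ℝ V / 2)) ℂ :=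
  Matrix.of fun i j => Φ (f (Pi.single j 1)) i

theorem frameMatrix_mulVec (f : (Fin (Module.finrank ℝ V / 2) → ℝ) →L[ℝ] V)
    (a : Fin (Module.finrank ℝ V / 2) → ℝ) :
    (frameMatrix Φ f).mulVec (fun j => (a j : ℂ)) = Φ (f a) := by
  conv_rhs => rw [pi_eq_sum_univ' a]
  ext i
  simp only [Matrix.mulVec, dotProduct, frameMatrix, Matrix.of_apply, map_sum, map_smul,
    Finset.sum_apply, Pi.smul_apply, Complex.real_smul]
  exact Finset.sum_congr rfl fun j _ => mul_comm _ _

/-- Lagrangian subspaces are totally real: if `f a + J (f b) = 0`, pairing with `f b` gives `ω(f b,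
J (f b)) = 0`, so `f b = 0` and then `f a = 0`. A real frame is thus a complex basis. -/
theorem frameMatrix_det_ne_zero (hΦ : ∀ x, Φ (C.J x) = Complex.I • Φ x) (f : LagrangianFrame ω) :
    (frameMatrix Φ f.1).det ≠ 0 := by
  intro h0
  obtain ⟨c, hc, h⟩ := Matrix.exists_mulVec_eq_zero_iff.2 h0
  refine hc ?_
  let a : Fin (Module.finrank ℝ V / 2) → ℝ := fun j => (c j).re
  let b : Fin (Module.finrank ℝ V / 2) → ℝ := fun j => (c j).im
  have hab : c = (fun j => (a j : ℂ)) + Complex.I • (fun j => (b j : ℂ)) := by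
    ext j
    simp [a, b, mul_comm Complex.I, Complex.re_add_im]
  rw [hab, Matrix.mulVec_add, Matrix.mulVec_smul, frameMatrix_mulVec, frameMatrix_mulVec, ← hΦ,
    ← map_add, LinearEquiv.map_eq_zero_iff] at h
  have hL : ∀ x y, ω.form (f.1 x) (f.1 y) = 0 := by
    intro x y
    have : f.1 y ∈ ω.form.orthogonal (LinearMap.range f.1.toLinearMap) := by
      rw [show ω.form.orthogonal _ = _ from f.2.2]
      exact ⟨y, rfl⟩
    exact LinearMap.BilinForm.mem_orthogonal_iff.1 this _ ⟨x, rfl⟩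
  have hb : f.1 b = 0 := by
    by_contra hb
    have h2 := C.pos _ hb
    have h3 := congrArg (fun x => ω.form (f.1 b) x) h
    simp only [map_add, hL, zero_add, map_zero] at h3
    exact h2.ne' h3
  rw [hb, map_zero, add_zero] at h
  have ha0 : a = 0 := f.2.1 (h.trans (map_zero _).symm)
  have hb0 : b = 0 := f.2.1 (hb.trans (map_zero _).symm)
  rw [hab, ha0, hb0]
  ext j; simp

/-- Two frames of one subspace differ by a real matrix, whose real determinant cancels in `conj d /
d`. -/
theorem exists_frameMatrix_det_eq {f f' : LagrangianFrame ω} (h : f.span = f'.span) :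
    ∃ r : ℝ, (frameMatrix Φ f'.1).det = (frameMatrix Φ f.1).det * r := by
  have hr : LinearMap.range f.1.toLinearMap = LinearMap.range f'.1.toLinearMap :=
    congrArg Subtype.val h
  have : ∀ j, ∃ a, f.1 a = f'.1 (Pi.single j 1) := by
    intro j
    have : f'.1 (Pi.single j 1) ∈ LinearMap.range f'.1.toLinearMap := ⟨_, rfl⟩
    rw [← hr] at this
    exact this
  choose a ha using this
  let A : Matrix (Fin (Module.finrank ℝ V / 2)) (Fin (Module.finrank ℝ V / 2)) ℝ :=
    Matrix.of fun i j => a j i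
  refine ⟨A.det, ?_⟩
  have : frameMatrix Φ f'.1 = frameMatrix Φ f.1 * Complex.ofRealHom.mapMatrix A := by
    ext i j
    have := congrFun (frameMatrix_mulVec Φ f.1 (a j)) i
    rw [ha] at this
    exact this.symm
  rw [this, Matrix.det_mul, ← RingHom.map_det]
  rfl

/-- The phase `conj d / d` of the complex determinant `d` of a frame. -/
def framePhase (hΦ : ∀ x, Φ (C.J x) = Complex.I • Φ x) (f : LagrangianFrame ω) : Circle :=
  Circle.ofConjDivSelf (frameMatrix Φ f.1).det (frameMatrix_det_ne_zero Φ hΦ f)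

variable {Φ}

theorem framePhase_congr (hΦ : ∀ x, Φ (C.J x) = Complex.I • Φ x) {f f' : LagrangianFrame ω}
    (h : f.span = f'.span) : framePhase Φ hΦ f' = framePhase Φ hΦ f := by
  obtain ⟨r, hr⟩ := exists_frameMatrix_det_eq Φ h
  have h0 := frameMatrix_det_ne_zero Φ hΦ f'
  have h1 := frameMatrix_det_ne_zero Φ hΦ f
  have hr0 : (r : ℂ) ≠ 0 := by
    intro h2
    rw [hr, h2, mul_zero] at h0
    exact h0 rfl
  refine Circle.ext ?_
  simp only [framePhase, Circle.ofConjDivSelf_coe, hr, map_mul, Complex.conj_ofReal]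
  field_simp

variable [FiniteDimensional ℝ V]

theorem continuous_framePhase (hΦ : ∀ x, Φ (C.J x) = Complex.I • Φ x) :
    Continuous (framePhase Φ hΦ) := by
  have hd : Continuous fun f : LagrangianFrame ω => (frameMatrix Φ f.1).det := by
    refine Continuous.matrix_det (continuous_matrix fun i j => ?_)
    have h1 : Continuous Φ := LinearMap.continuous_of_finiteDimensional Φ.toLinearMap
    have h2 : Continuous fun f : LagrangianFrame ω => f.1 (Pi.single j 1) :=
      continuous_subtype_val.clm_apply continuous_const
    exact (continuous_apply i).comp (h1.comp h2)
  refine Continuous.subtype_mk ?_ _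
  exact (Complex.continuous_conj.comp hd).div hd fun f => frameMatrix_det_ne_zero Φ hΦ f

/-- The Maslov phase of a Lagrangian subspace. -/
def phase (hΦ : ∀ x, Φ (C.J x) = Complex.I • Φ x) (L : LagrangianGrassmannian ω) : Circle :=
  framePhase Φ hΦ (LagrangianFrame.span_surjective ω L).choose

theorem phase_span (hΦ : ∀ x, Φ (C.J x) = Complex.I • Φ x) (f : LagrangianFrame ω) :
    phase hΦ f.span = framePhase Φ hΦ f :=
  framePhase_congr hΦ (LagrangianFrame.span_surjective ω f.span).choose_spec.symm

theorem continuous_phase (hΦ : ∀ x, Φ (C.J x) = Complex.I • Φ x) :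
    Continuous (phase (ω := ω) hΦ) := by
  rw [← (LagrangianFrame.isOpenQuotientMap_span ω).continuous_comp_iff]
  exact (continuous_framePhase hΦ).congr fun f => (phase_span hΦ f).symm

/-- The coefficient of `e` in `x`, as a complex linear form. -/
def coeffForm (hΦ : ∀ x, Φ (C.J x) = Complex.I • Φ x) (e : V) :
    (Fin (Module.finrank ℝ V / 2) → ℂ) →ₗ[ℂ] ℂ where
  toFun y := ω.form (Φ.symm y) (C.J e) + ω.form e (Φ.symm y) * Complex.I
  map_add' x y := by
    simp only [map_add, LinearMap.add_apply]; push_cast; ring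
  map_smul' z y := by
    have h : Φ.symm (z • y) = z.re • Φ.symm y + z.im • C.J (Φ.symm y) := by
      rw [LinearEquiv.symm_apply_eq, map_add, map_smul, map_smul, hΦ, LinearEquiv.apply_symm_apply]
      ext i
      simp only [Pi.smul_apply, Pi.add_apply, smul_eq_mul, Complex.real_smul]
      conv_lhs => rw [← Complex.re_add_im z]
      ring
    rw [h]
    simp only [map_add, map_smul, LinearMap.add_apply, LinearMap.smul_apply, C.symp, smul_eq_mul,
      ω.form_swap (Φ.symm y) e, C.form_J_comm e (Φ.symm y), RingHom.id_apply]
    conv_rhs => rw [← Complex.re_add_im z]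
    push_cast
    linear_combination (-(z.im : ℂ) * ω.form e (Φ.symm y)) * Complex.I_sq

/-- In complex coordinates the rotation is a linear transvection: the identity plus `exp(iθ) - 1`
times the projection to the complex line of `e`. Its determinant is `1 + (exp(iθ) - 1)`. -/
theorem frameMatrix_rot_det (hΦ : ∀ x, Φ (C.J x) = Complex.I • Φ x) {e : V}
    (he : ω.form e (C.J e) = 1) (θ : ℝ) (f : (Fin (Module.finrank ℝ V / 2) → ℝ) →L[ℝ] V) :
    (frameMatrix Φ (((rot he θ).1 : V →L[ℝ] V).comp f)).det =
      Complex.exp (θ * Complex.I) * (frameMatrix Φ f).det := by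
  let T := LinearMap.transvection ((Complex.exp (θ * Complex.I) - 1) • coeffForm hΦ e) (Φ e)
  have hT : ∀ x, Φ (Sp.app (rot he θ) x) = T (Φ x) := by
    intro x
    rw [rot_app, LinearMap.transvection.apply]
    simp only [map_add, map_smul, hΦ, coeffForm, LinearMap.smul_apply, LinearMap.coe_mk,
      AddHom.coe_mk, LinearEquiv.symm_apply_apply]
    ext i
    simp only [Pi.smul_apply, Pi.add_apply, smul_eq_mul, Complex.real_smul, Complex.exp_mul_I]
    push_cast
    linear_combination (-Complex.sin θ * ω.form e x * Φ e i) * Complex.I_sq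
  have hM : frameMatrix Φ (((rot he θ).1 : V →L[ℝ] V).comp f) =
      LinearMap.toMatrix' T * frameMatrix Φ f := by
    ext i j
    have := congrFun (hT (f (Pi.single j 1))) i
    refine this.trans ?_
    rw [← LinearMap.toMatrix'_mulVec]
    rfl
  rw [hM, Matrix.det_mul, LinearMap.det_toMatrix', LinearMap.transvection.det]
  congr 1
  simp [coeffForm, he]

theorem phase_rot_smul (hΦ : ∀ x, Φ (C.J x) = Complex.I • Φ x) {e : V}
    (he : ω.form e (C.J e) = 1) (θ : ℝ) (L : LagrangianGrassmannian ω) :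
    phase hΦ (rot he θ • L) = Circle.exp (-2 * θ) * phase hΦ L := by
  obtain ⟨f, rfl⟩ := LagrangianFrame.span_surjective ω L
  have hr : LinearMap.range (((rot he θ).1 : V →L[ℝ] V).comp f.1).toLinearMap =
      (LinearMap.range f.1.toLinearMap).map (((rot he θ).1 : V →L[ℝ] V) : V →ₗ[ℝ] V) :=
    LinearMap.range_comp _ _
  let f' : LagrangianFrame ω := ⟨((rot he θ).1 : V →L[ℝ] V).comp f.1,
    (Sp.app_injective (rot he θ)).comp f.2.1, hr.symm ▸ f.2.2.map (rot he θ)⟩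
  have hf' : rot he θ • f.span = f'.span := Subtype.ext hr.symm
  rw [hf', phase_span, phase_span]
  refine Circle.ext ?_
  have h0 := frameMatrix_det_ne_zero Φ hΦ f
  simp only [framePhase, Circle.ofConjDivSelf_coe, Circle.coe_mul, Circle.coe_exp, f',
    frameMatrix_rot_det hΦ, map_mul, ← Complex.exp_conj, Complex.conj_ofReal, Complex.conj_I]
  rw [mul_div_mul_comm, ← Complex.exp_sub]
  congr 2
  push_cast
  ring

/-- A path of rotations that fixes a point of the universal cover of the Lagrangian Grassmannian
ends at the angle `0`. -/
theorem angle_eq_zero_of_smul_eq {e : V} (he : ω.form e (C.J e) = 1) {θ : C(I, ℝ)} (hθ : θ 0 = 0)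
    {L₀ : LagrangianGrassmannian ω} {x : UniversalCover (LagrangianGrassmannian ω) L₀}
    (h : UniversalCover.mk (rotPath he θ hθ) • x = x) : θ 1 = 0 := by
  obtain ⟨Φ, hΦ⟩ := C.exists_complexCoordinates
  obtain ⟨l, rfl⟩ : ∃ l, UniversalCover.mk l = x := Quotient.exists_rep x
  obtain ⟨H⟩ : ContinuousMap.HomotopicRel
      (UniversalCover.actPath (rotPath he θ hθ) l).1 l.1 {0, 1} :=
    Quotient.exact (s := pathsFromSetoid (LagrangianGrassmannian ω) L₀) h
  have hμ := continuous_phase (ω := ω) hΦ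
  let f₀ : C(I, ℝ) := ⟨fun s => -2 * θ s, by fun_prop⟩
  -- Dividing the phase along the homotopy `H` by the phase along `l` gives a homotopy in the
  -- circle, relative to the endpoints, from `exp(-2iθ)` to the constant `1`. It lifts to `ℝ` and so
  -- fixes the final value of `-2θ`.
  have key : f₀.HomotopicRel (ContinuousMap.const I 0) {0, 1} := by
    refine (Circle.isCoveringMap_exp.homotopicRel_iff_comp ⟨0, by simp, by simp [f₀, hθ]⟩).2 ?_
    have hq : ∀ s, phase hΦ (UniversalCover.actPath (rotPath he θ hθ) l |>.1 s) / phase hΦ (l.1 s) =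
        Circle.exp (f₀ s) := fun s => by
      change phase hΦ (rot he (θ s) • l.1 s) / _ = _
      rw [phase_rot_smul, mul_div_cancel_right]
      rfl
    refine ⟨⟨⟨⟨fun p => phase hΦ (H p) / phase hΦ (l.1 p.2), ?_⟩, ?_, ?_⟩, ?_⟩⟩
    · exact (hμ.comp H.continuous).div' (hμ.comp (l.1.continuous.comp continuous_snd))
    · intro s
      simpa using hq s
    · intro s
      simp
    · intro u s hs
      have := H.eq_fst u hs
      change phase hΦ (H (u, s)) / phase hΦ (l.1 s) = Circle.exp (f₀ s)
      rw [this]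
      exact hq s
  have := key.fst_eq_snd (x := 1) (by simp)
  simpa [f₀] using this

end CompatibleComplexStructure

/-! ### Fixed points of transvections and their lifts -/

section

variable {V : Type*} [NormedAddCommGroup V] [NormedSpace ℝ V]
  {ω : SymplecticForm V} {L₀ : LagrangianGrassmannian ω}

theorem IsLagrangian.form_eq_zero {L : Submodule ℝ V} (hL : IsLagrangian ω L) {x y : V}
    (hx : x ∈ L) (hy : y ∈ L) : ω.form x y = 0 := by
  rw [← (hL : ω.form.orthogonal L = L), LinearMap.BilinForm.mem_orthogonal_iff] at hy
  exact hy x hx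

theorem IsLagrangian.exists_form_ne_zero {L : Submodule ℝ V} (hL : IsLagrangian ω L) {a : V}
    (ha : a ∉ L) : ∃ x ∈ L, ω.form a x ≠ 0 := by
  by_contra! h
  refine ha ?_
  rw [← (hL : ω.form.orthogonal L = L), LinearMap.BilinForm.mem_orthogonal_iff]
  intro x hx
  change ω.form x a = 0
  rw [ω.form_swap, h x hx, neg_zero]

variable [FiniteDimensional ℝ V]

open UniversalCover

/-- The fundamental group of the symplectic group acts freely on the universal cover of the
Lagrangian Grassmannian. -/
theorem UniversalCover.eq_one_of_smul_eq {c : UniversalCover (Sp ω) 1} (hc : proj c = 1)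
    {x : UniversalCover (LagrangianGrassmannian ω) L₀} (hx : c • x = x) : c = 1 := by
  obtain ⟨γ, rfl⟩ : ∃ γ, mk γ = c := Quotient.exists_rep c
  obtain ⟨C⟩ := ω.nonempty_compatible
  rcases C.exists_rotPath (γ := γ) hc with h | ⟨e, he, θ, hθ, h⟩
  · exact h
  · rw [h] at hx ⊢
    have h1 := CompatibleComplexStructure.angle_eq_zero_of_smul_eq he hθ hx
    refine mk_eq_mk_of_homotopy
      (fun p => CompatibleComplexStructure.rot he ((1 - (p.1 : ℝ)) * θ p.2)) (by fun_prop) ?_ ?_ ?_ ?_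
    · intro s
      simp [CompatibleComplexStructure.rotPath]
    · intro s
      simp
    · intro u; simp [hθ]
    · intro u; simp [h1, CompatibleComplexStructure.rotPath]

theorem transvection_smul_of_mem {L : LagrangianGrassmannian ω} {a : V} (ha : a ∈ L.1) (s : ℝ) :
    transvection ω a s • L = L := by
  refine Subtype.ext (Submodule.ext fun y => ?_)
  rw [LagrangianGrassmannian.mem_smul_iff]
  constructor
  · rintro ⟨x, hx, rfl⟩
    rwa [Sp.app_transvection, L.2.form_eq_zero ha hx, mul_zero, zero_smul, add_zero]
  · intro hy
    refine ⟨y, hy, ?_⟩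
    rw [Sp.app_transvection, L.2.form_eq_zero ha hy, mul_zero, zero_smul, add_zero]

/-- If `a ∉ L`, some `x ∈ L` has `ω(a, x) ≠ 0`. Then `T x - x` is a nonzero multiple of `a` that
lies in `L`, which is absurd. -/
theorem mem_of_transvection_smul_eq {L : LagrangianGrassmannian ω} {a : V} {s : ℝ} (hs : s ≠ 0)
    (h : transvection ω a s • L = L) : a ∈ L.1 := by
  by_contra ha
  obtain ⟨x, hx, hax⟩ := L.2.exists_form_ne_zero ha
  have h1 : Sp.app (transvection ω a s) x ∈ (transvection ω a s • L).1 := ⟨x, hx, rfl⟩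
  rw [h] at h1
  rw [Sp.app_transvection] at h1
  exact ha ((Submodule.smul_mem_iff _ (mul_ne_zero hs hax)).1
    ((Submodule.add_mem_iff_right _ hx).1 h1))

/-- Every vector lies in a Lagrangian subspace that can be joined to a given one by a path. -/
theorem exists_mem_proj (L₀ : LagrangianGrassmannian ω) (a : V) :
    ∃ x : UniversalCover (LagrangianGrassmannian ω) L₀, a ∈ (proj x).1 := by
  by_cases ha : a ∈ L₀.1
  · exact ⟨mk ⟨ContinuousMap.const I L₀, rfl⟩, ha⟩
  obtain ⟨e, he, hae⟩ := L₀.2.exists_form_ne_zero ha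
  -- The final parameter is chosen so that the transvection along `a - e` takes `e ∈ L₀` to `a`.
  let l : PathsFrom (LagrangianGrassmannian ω) L₀ :=
    ⟨⟨fun s => transvection ω (a - e) (s * (ω.form a e)⁻¹) • L₀, by fun_prop⟩, by simp⟩
  refine ⟨mk l, e, he, ?_⟩
  change Sp.app (transvection ω (a - e) ((1 : I) * (ω.form a e)⁻¹)) e = a
  simp [hae]

/-- The lift of a transvection along the path of its multiples. -/
def transvectionLift (ω : SymplecticForm V) (a : V) (s : ℝ) : UniversalCover (Sp ω) 1 :=
  mk ⟨⟨fun r => transvection ω a (r * s), by fun_prop⟩, by simp⟩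

theorem proj_transvectionLift (a : V) (s : ℝ) :
    proj (transvectionLift ω a s) = transvection ω a s := by
  change transvection ω a ((1 : I) * s) = _
  simp

/-- The condition `a ∈ L` for `T_a(s)` to fix `L` does not involve `s ≠ 0`, so what the endpoint of
the path fixes is fixed at all times. -/
theorem transvectionLift_smul_eq_iff (a : V) (s : ℝ)
    (x : UniversalCover (LagrangianGrassmannian ω) L₀) :
    transvectionLift ω a s • x = x ↔ transvection ω a s • proj x = proj x := by
  constructor
  · intro h
    rw [← proj_transvectionLift, ← proj_smul, h]
  · intro h
    obtain ⟨l, rfl⟩ : ∃ l, mk l = x := Quotient.exists_rep x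
    refine mk_smul_eq_self _ _ fun r => ?_
    change transvection ω a (r * s) • l.1 1 = l.1 1
    rcases eq_or_ne s 0 with rfl | hs
    · simp
    · exact transvection_smul_of_mem (mem_of_transvection_smul_eq hs h) _

end

theorem lemma4p1 {V : Type*} [NormedAddCommGroup V] [NormedSpace ℝ V] [FiniteDimensional ℝ V]
    (ω : SymplecticForm V) (L₀ : LagrangianGrassmannian ω)
    (t : Sp ω) (ht : IsSymplecticTransvection ω t) :
    (∃! τ : UniversalCover (Sp ω) 1, UniversalCover.proj τ = t ∧
      (MulAction.fixedBy (UniversalCover (LagrangianGrassmannian ω) L₀) τ).Nonempty) ∧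
    ∀ τ : UniversalCover (Sp ω) 1, UniversalCover.proj τ = t →
      (MulAction.fixedBy (UniversalCover (LagrangianGrassmannian ω) L₀) τ).Nonempty →
      MulAction.fixedBy (UniversalCover (LagrangianGrassmannian ω) L₀) τ =
        UniversalCover.proj ⁻¹' MulAction.fixedBy (LagrangianGrassmannian ω) t := by
  obtain ⟨a, s, rfl⟩ := ht
  have huniq : ∀ τ : UniversalCover (Sp ω) 1, UniversalCover.proj τ = transvection ω a s →
      (MulAction.fixedBy (UniversalCover (LagrangianGrassmannian ω) L₀) τ).Nonempty →
      τ = transvectionLift ω a s := by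
    rintro τ hτ ⟨x, hx⟩
    have hx : τ • x = x := hx
    have h1 : transvectionLift ω a s • x = x := by
      rw [transvectionLift_smul_eq_iff, ← hτ, ← UniversalCover.proj_smul, hx]
    -- Both lifts fix `x`, so their quotient is an element above `1` that fixes `x`, and freeness
    -- applies.
    refine (inv_mul_eq_one.1 (UniversalCover.eq_one_of_smul_eq (x := x) ?_ ?_)).symm
    · have h2 := UniversalCover.proj_mul (transvectionLift ω a s) ((transvectionLift ω a s)⁻¹ * τ)
      rw [mul_inv_cancel_left, hτ, proj_transvectionLift] at h2
      exact mul_eq_left.1 h2.symm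
    · rw [mul_smul, hx, inv_smul_eq_iff, h1]
  refine ⟨⟨transvectionLift ω a s, ⟨proj_transvectionLift a s, ?_⟩, fun τ h => huniq τ h.1 h.2⟩, ?_⟩
  · obtain ⟨x, hx⟩ := exists_mem_proj L₀ a
    exact ⟨x, (transvectionLift_smul_eq_iff a s x).2 (transvection_smul_of_mem hx s)⟩
  · intro τ h1 h2
    rw [huniq τ h1 h2]
    ext x
    exact transvectionLift_smul_eq_iff a s x

end
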